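/- Fix a constant $K>0$. A Fermi polyhedron construction with constant $K$ consists of the following. (i) Reals $k_F,L>0$ with $R:=\frac{Lk_F}{2\pi}$ rational, a real $Q>0$, an integer $s\ge 1$ and three distinct primes $Q_1,Q_2,Q_3$ with $K^{-1}Q\le Q_j\le KQ$. (ii) Points $\kappa^{\mathbb R}_1,\dots,\kappa^{\mathbb R}_s$ on the sphere of radius $Q^{-3/4}$ in $\mathbb R^3$ such that any two of them (with different indices) have distance at least $K^{-1}s^{-1/2}Q^{-3/4}$, every point of this sphere has distance at most $Ks^{-1/2}Q^{-3/4}$ to one of them, and the set $\{\kappa^{\mathbb R}_1,\dots,\kappa^{\mathbb R}_s\}$ is invariant under all maps $(k^1,k^2,k^3)\mapsto(\pm k^a,\pm k^b,\pm k^c)$, $\{a,b,c\}=\{1,2,3\}$. (iii) Points $\kappa_j=(p_j^1/Q_1,p_j^2/Q_2,p_j^3/Q_3)$, $p_j^\mu\in\mathbb Z$, $j=1,\dots,s$, with $|\kappa_j-\kappa_j^{\mathbb R}|\le KQ^{-1}$ for all $j$, such that the set $\{\kappa_1,\dots,\kappa_s\}$ is invariant under all maps $(k^1,k^2,k^3)\mapsto(\pm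 k^1,\pm k^2,\pm k^3)$. (iv) The polyhedron $P=\sigma\,\mathrm{conv}\{\kappa_1,\dots,\kappa_s\}$, where $\sigma>0$ is such that $\mathrm{Vol}(P)=4\pi/3$, the Fermi polyhedron $P_F=k_FP\cap\frac{2\pi}{L}\mathbb Z^3$, and $N=\#P_F$. It is required that $Q^{-1/4}\le Ks^{-1}$ and $Q\le KN^K$. Lemma. For every $K$ there is a constant $C>0$ such that the following holds. For every sequence of Fermi polyhedron constructions with constant $K$ along which $N\to\infty$, $s\to\infty$ and $N^{4/3}/Q\to0$, one has, for all sufficiently large indices in the sequence and all $\mu,\nu\in\{1,2,3\}$, $$\int_{[0,2\pi]^3}\Big|\sum_{q\in RP\cap\mathbb Z^3}q^\mu e^{iq\cdot u}\Big|\,du\le C\,s\,N^{1/3}(\log N)^3,$$ $$\int_{[0,2\pi]^3}\Big|\sum_{q\in RP\cap\mathbb Z^3}q^\mu q^\nu e^{iq\cdot u}\Big|\,du\le C\,s\,N^{2/3}(\log N)^4.$$ -/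

import Mathlib

open Filter Asymptotics
open scoped Topology Pointwise

noncomputable section

/-- Euclidean three-space. -/
abbrev E3 : Type := EuclideanSpace ℝ (Fin 3)

/-- The raw data entering the construction of the Fermi polyhedron. -/
structure FermiData where
  /-- the Fermi momentum -/
  kF : ℝ
  /-- the side length of the box -/
  L : ℝ
  /-- the size of the primes -/
  Q : ℝ
  /-- the number of corners -/
  s : ℕ
  /-- the three primes `Q₁, Q₂, Q₃` -/
  prime : Fin 3 → ℕ
  /-- the initial points on the sphere of radius `Q ^ (-3/4)` -/
  κR : Fin s → E3
  /-- the numerators of the coordinates of the corrected points -/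
  p : Fin s → Fin 3 → ℤ
  /-- the scaling factor -/
  σ : ℝ

namespace FermiData

variable (D : FermiData)

/-- The points `κ_j = (p_j¹ / Q₁, p_j² / Q₂, p_j³ / Q₃)`. -/
def κ (j : Fin D.s) : E3 :=
  WithLp.toLp 2 (fun i => (D.p j i : ℝ) / (D.prime i : ℝ))

/-- The unscaled polyhedron: the convex hull of the points `κ_j`. -/
def Ptilde : Set E3 := convexHull ℝ (Set.range D.κ)

/-- The polyhedron `P = σ P̃`. -/
def P : Set E3 := D.σ • D.Ptilde

/-- The Fermi polyhedron `P_F = k_F P ∩ (2π/L) ℤ³`. -/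
def PF : Set E3 :=
  (D.kF • D.P) ∩ {k | ∃ q : Fin 3 → ℤ, ∀ i, k i = 2 * Real.pi / D.L * (q i : ℝ)}

/-- The number of particles `N = #P_F`. -/
def N : ℕ := D.PF.ncard

/-- `R = L k_F / 2π`. -/
def R : ℝ := D.L * D.kF / (2 * Real.pi)

/-- The lattice points `q ∈ ℤ³` with `q ∈ R P`. -/
def latticeSet : Set (Fin 3 → ℤ) :=
  {q | (WithLp.toLp 2 (fun i => (q i : ℝ)) : E3) ∈ D.R • D.P}

theorem latticeSet_finite : D.latticeSet.Finite := by
  have hc : Bornology.IsBounded (D.R • D.P) := by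
    have h1 : IsCompact D.Ptilde := (Set.finite_range D.κ).isCompact_convexHull ℝ
    exact ((h1.smul D.σ).smul D.R).isBounded
  obtain ⟨B, hB⟩ := hc.exists_norm_le
  refine (Set.finite_Icc (fun _ : Fin 3 => -⌈B⌉) (fun _ => ⌈B⌉)).subset ?_
  intro q hq
  have h2 : ∀ i, |(q i : ℝ)| ≤ B := fun i => by
    have := PiLp.norm_apply_le (WithLp.toLp 2 (fun i => (q i : ℝ)) : E3) i
    exact this.trans (hB _ hq)
  refine ⟨fun i => ?_, fun i => ?_⟩
  · have h3 := (abs_le.mp (h2 i)).1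
    have h4 := Int.le_ceil B
    have : (-(⌈B⌉ : ℤ) : ℝ) ≤ (q i : ℝ) := by linarith
    exact_mod_cast this
  · have h3 := (abs_le.mp (h2 i)).2
    have h4 := Int.le_ceil B
    have : (q i : ℝ) ≤ ((⌈B⌉ : ℤ) : ℝ) := by linarith
    exact_mod_cast this

/-- The finite set `R P ∩ ℤ³`. -/
def lattice : Finset (Fin 3 → ℤ) := D.latticeSet_finite.toFinset

/-- The data `D` is a Fermi polyhedron construction in which all the implied constants
(in `≲`, `∼`, and "for some constants `c, C`") are controlled by `K`. -/
structure IsFermiPolyhedron (K : ℝ) : Prop where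
  kF_pos : 0 < D.kF
  L_pos : 0 < D.L
  R_rational : ∃ r : ℚ, D.L * D.kF / (2 * Real.pi) = (r : ℝ)
  Q_pos : 0 < D.Q
  Q_lower : D.Q ^ (-(1 / 4) : ℝ) ≤ K * (D.s : ℝ)⁻¹
  Q_upper : D.Q ≤ K * (D.N : ℝ) ^ K
  prime_prime : ∀ i, (D.prime i).Prime
  prime_distinct : Function.Injective D.prime
  prime_lower : ∀ i, K⁻¹ * D.Q ≤ (D.prime i : ℝ)
  prime_upper : ∀ i, (D.prime i : ℝ) ≤ K * D.Q
  /-- the initial points lie on the sphere of radius `Q ^ (-3/4)` -/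
  κR_sphere : ∀ j, ‖D.κR j‖ = D.Q ^ (-(3 / 4) : ℝ)
  /-- evenly distributed, first part: separation -/
  κR_separated : ∀ i j, i ≠ j →
    K⁻¹ * (D.s : ℝ) ^ (-(1 / 2) : ℝ) * D.Q ^ (-(3 / 4) : ℝ) ≤ dist (D.κR i) (D.κR j)
  /-- evenly distributed, second part: covering -/
  κR_covering : ∀ k : E3, ‖k‖ = D.Q ^ (-(3 / 4) : ℝ) →
    ∃ j, dist k (D.κR j) ≤ K * (D.s : ℝ) ^ (-(1 / 2) : ℝ) * D.Q ^ (-(3 / 4) : ℝ)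
  /-- invariance of the initial points under `(k¹, k², k³) ↦ (± kᵃ, ± kᵇ, ± kᶜ)` -/
  κR_symm : ∀ (π : Equiv.Perm (Fin 3)) (ε : Fin 3 → ℤˣ), ∀ x ∈ Set.range D.κR,
    (WithLp.toLp 2 (fun i => (((ε i : ℤˣ) : ℤ) : ℝ) * x (π i)) : E3) ∈ Set.range D.κR
  /-- the corrected points are close to the initial ones -/
  κ_close : ∀ j, dist (D.κ j) (D.κR j) ≤ K * D.Q⁻¹
  /-- invariance of the corrected points under `(k¹, k², k³) ↦ (± k¹, ± k², ± k³)` -/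
  κ_symm : ∀ (ε : Fin 3 → ℤˣ), ∀ x ∈ Set.range D.κ,
    (WithLp.toLp 2 (fun i => (((ε i : ℤˣ) : ℤ) : ℝ) * x i) : E3) ∈ Set.range D.κ
  σ_pos : 0 < D.σ
  /-- normalization of the volume -/
  volume_P : MeasureTheory.volume D.P = ENNReal.ofReal (4 * Real.pi / 3)

end FermiData

/-- The integral over `[0, 2π]³` of `|∑_{q ∈ Ω} t(q) e^{i q · u}|`. -/
def derivativeLebesgue (Ω : Finset (Fin 3 → ℤ)) (t : (Fin 3 → ℤ) → ℝ) : ℝ :=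
  ∫ u in Set.Icc (0 : Fin 3 → ℝ) (fun _ => 2 * Real.pi),
    ‖∑ q ∈ Ω, (t q : ℂ) * Complex.exp (Complex.I * ((∑ i, (q i : ℝ) * u i : ℝ) : ℂ))‖

end

noncomputable section

open MeasureTheory

/-! ### Trigonometric polynomials on the cube `[0, 2π]³` -/

/-! The sum is obtained from a kernel of small `L¹` norm by cutting its spectrum with rational
half-spaces, and the cost of the cuts is counted in logarithms.

One cut: on a finite spectrum the integer `l · q` takes at most `2M + 1` values, so the indicator of
`l · q ≤ b` is a discrete Fourier sum of characters. Multiplying coefficients by a character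
translates the polynomial, which leaves its `L¹` norm unchanged; the total mass of the Fourier
coefficients is `O(log M)` (`lebesgueNorm_halfSpace_le`).

Many cuts: four normals in dimension three are linearly dependent, so some pattern of satisfied and
violated constraints is impossible (`exists_infeasible_sign_pattern`). Inclusion-exclusion over this
pattern reduces any number of half-spaces to at most three, so a bounded number of them costs only
three logarithms (`lebesgueNorm_cutCoeff_le`).

Few cuts suffice locally: `ℤ³ \ {0}` is split into `O(s)` rational cones of aperture of order
`s^(-1/2)`. The facet most violated by an outside point has its corners within `O(s^(-1/2))` of the
direction of that point (`IsSphereNet.norm_sub_le_of_tight`). Separation leaves boundedly many such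
corners per cone (`card_le_of_separated`), hence boundedly many facets
(`exists_halfSpaces_of_coneKey`). Rationality of the corners gives integer normals of size
polynomial in `Q` (`exists_int_normal`), so each logarithm is `O(log N)`.

The weight is free of logarithms: on a box of side of order `N^(1/3)` the monomials of degree `d =
1, 2` are coefficients of a product of two polynomials divided by a box count, with `L¹` norm
`O(N^(d/3))` by Cauchy–Schwarz and Parseval (`exists_kernel_of_split`). Summing over the cones
(`lebesgueNorm_le_of_cones`) gives `s N^(d/3) (log N)³` in both cases. -/

/-- The exponential `u ↦ e^{i q · u}`. -/
def expChar (q : Fin 3 → ℤ) (u : Fin 3 → ℝ) : ℂ :=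
  Complex.exp (Complex.I * ((∑ i, (q i : ℝ) * u i : ℝ) : ℂ))

/-- The cube `[0, 2π]³`. -/
def cube : Set (Fin 3 → ℝ) := Set.Icc (0 : Fin 3 → ℝ) (fun _ => 2 * Real.pi)

/-- The trigonometric polynomial with frequencies in `Ω` and coefficients `c`. -/
def trigPoly (Ω : Finset (Fin 3 → ℤ)) (c : (Fin 3 → ℤ) → ℂ) (u : Fin 3 → ℝ) : ℂ :=
  ∑ q ∈ Ω, c q * expChar q u

/-- The `L¹` norm on `[0, 2π]³` of a trigonometric polynomial. -/
def lebesgueNorm (Ω : Finset (Fin 3 → ℤ)) (c : (Fin 3 → ℤ) → ℂ) : ℝ :=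
  ∫ u in cube, ‖trigPoly Ω c u‖

theorem derivativeLebesgue_eq (Ω : Finset (Fin 3 → ℤ)) (t : (Fin 3 → ℤ) → ℝ) :
    derivativeLebesgue Ω t = lebesgueNorm Ω (fun q => (t q : ℂ)) := rfl

theorem continuous_expChar (q : Fin 3 → ℤ) : Continuous (expChar q) := by
  unfold expChar; fun_prop

theorem expChar_add_freq (q q' : Fin 3 → ℤ) (u : Fin 3 → ℝ) :
    expChar (q + q') u = expChar q u * expChar q' u := by
  simp only [expChar, ← Complex.exp_add, ← mul_add, ← Complex.ofReal_add,
    ← Finset.sum_add_distrib, Pi.add_apply, Int.cast_add, add_mul]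

theorem expChar_add_point (q : Fin 3 → ℤ) (u v : Fin 3 → ℝ) :
    expChar q (u + v) = expChar q u * expChar q v := by
  simp only [expChar, ← Complex.exp_add, ← mul_add, ← Complex.ofReal_add,
    ← Finset.sum_add_distrib, Pi.add_apply]

theorem expChar_neg (q : Fin 3 → ℤ) (u : Fin 3 → ℝ) :
    expChar (-q) u = (starRingEnd ℂ) (expChar q u) := by
  rw [expChar, expChar, ← Complex.exp_conj]
  congr 1
  simp [Finset.sum_neg_distrib]

theorem continuous_trigPoly (Ω : Finset (Fin 3 → ℤ)) (c : (Fin 3 → ℤ) → ℂ) :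
    Continuous (trigPoly Ω c) :=
  continuous_finsetSum _ fun q _ => continuous_const.mul (continuous_expChar q)

theorem isCompact_cube : IsCompact cube := isCompact_Icc

theorem integrableOn_cube {E : Type*} [NormedAddCommGroup E] {f : (Fin 3 → ℝ) → E}
    (hf : Continuous f) : IntegrableOn f cube :=
  hf.continuousOn.integrableOn_compact isCompact_cube

theorem volume_real_cube : volume.real cube = (2 * Real.pi) ^ 3 := by
  rw [Measure.real, cube, Real.volume_Icc_pi, ENNReal.toReal_prod]
  simp [Real.pi_pos.le]

/-- The quotient map preserves measure on the half-open cube, which differs from the closed one by a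
null set. On the torus, translation invariance is invariance of Haar measure. -/
theorem integral_cube_eq_torus {E : Type*} [NormedAddCommGroup E] [NormedSpace ℝ E]
    [Fact (0 < 2 * Real.pi)] {G : (Fin 3 → AddCircle (2 * Real.pi)) → E} (hG : Continuous G) :
    ∫ u in cube, G (fun i => (u i : AddCircle (2 * Real.pi))) = ∫ x, G x := by
  have hmp : MeasurePreserving
      (fun (u : Fin 3 → ℝ) (i : Fin 3) => (u i : AddCircle (2 * Real.pi)))
      (Measure.pi fun _ : Fin 3 => volume.restrict (Set.Ioc (0 : ℝ) (0 + 2 * Real.pi)))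
      (Measure.pi fun _ : Fin 3 => (volume : Measure (AddCircle (2 * Real.pi)))) :=
    measurePreserving_pi _ _ fun _ => AddCircle.measurePreserving_mk (2 * Real.pi) 0
  have hset : (volume : Measure (Fin 3 → ℝ)).restrict cube =
      Measure.pi fun _ : Fin 3 => volume.restrict (Set.Ioc (0 : ℝ) (0 + 2 * Real.pi)) := by
    rw [← Measure.restrict_pi_pi, zero_add]
    exact (Measure.restrict_congr_set Measure.univ_pi_Ioc_ae_eq_Icc).symm
  rw [hset, volume_pi, ← hmp.map_eq, integral_map hmp.measurable.aemeasurable]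
  exact hG.aestronglyMeasurable

/-- Integrals over `[0, 2π]³` of functions of a trigonometric polynomial are invariant under
translation. -/
theorem integral_trigPoly_add {E : Type*} [NormedAddCommGroup E] [NormedSpace ℝ E]
    {F : ℂ → E} (hF : Continuous F) (Ω : Finset (Fin 3 → ℤ)) (c : (Fin 3 → ℤ) → ℂ)
    (v : Fin 3 → ℝ) :
    ∫ u in cube, F (trigPoly Ω c (u + v)) = ∫ u in cube, F (trigPoly Ω c u) := by
  have : Fact (0 < 2 * Real.pi) := ⟨Real.two_pi_pos⟩
  let G : (Fin 3 → AddCircle (2 * Real.pi)) → E := fun x =>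
    F (∑ q ∈ Ω, c q * ∏ i, fourier (q i) (x i))
  have hG : Continuous G := by
    refine hF.comp (continuous_finsetSum _ fun q _ => continuous_const.mul
      (continuous_finsetProd _ fun i _ => (map_continuous _).comp (continuous_apply i)))
  have key : ∀ u : Fin 3 → ℝ, F (trigPoly Ω c u) = G fun i => (u i : AddCircle (2 * Real.pi)) := by
    intro u
    simp only [G, trigPoly, expChar]
    refine congrArg F (Finset.sum_congr rfl fun q _ => ?_)
    have hpi : (Real.pi : ℂ) ≠ 0 := by exact_mod_cast Real.pi_ne_zero
    simp only [fourier_coe_apply, ← Complex.exp_sum]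
    congr 2
    push_cast
    rw [Finset.mul_sum]
    refine Finset.sum_congr rfl fun i _ => ?_
    field_simp
  simp only [key]
  rw [integral_cube_eq_torus hG,
    ← integral_add_right_eq_self G (fun i => (v i : AddCircle (2 * Real.pi))),
    ← integral_cube_eq_torus (G := fun x => G (x + fun i => (v i : AddCircle (2 * Real.pi))))
      (hG.comp (continuous_id.add continuous_const))]
  rfl

theorem trigPoly_singleton (q : Fin 3 → ℤ) : trigPoly {q} (fun _ => 1) = expChar q := by
  ext u; simp [trigPoly]

/-- For `q ≠ 0` some translation multiplies the exponential by `-1`, so by translation invariance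
the integral equals its own negative. -/
theorem integral_expChar (q : Fin 3 → ℤ) :
    ∫ u in cube, expChar q u = if q = 0 then (((2 * Real.pi) ^ 3 : ℝ) : ℂ) else 0 := by
  split_ifs with h
  · subst h
    have : ∀ u, expChar 0 u = 1 := fun u => by simp [expChar]
    simp only [this, integral_const, measureReal_restrict_apply_univ, volume_real_cube]
    simp
  · obtain ⟨j, hj⟩ := Function.ne_iff.1 h
    have hj' : (q j : ℝ) ≠ 0 := by exact_mod_cast hj
    let v : Fin 3 → ℝ := Pi.single j (Real.pi / q j)
    have hv : expChar q v = -1 := by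
      have : (∑ i, (q i : ℝ) * v i) = Real.pi := by
        rw [Finset.sum_eq_single j]
        · simp only [v, Pi.single_eq_same]; field_simp
        · intro i _ hi; simp [v, Pi.single_eq_of_ne hi]
        · simp
      rw [expChar, this, mul_comm, Complex.exp_pi_mul_I]
    have h1 := integral_trigPoly_add continuous_id {q} (fun _ => 1) v
    simp only [trigPoly_singleton, expChar_add_point, hv, id] at h1
    rw [integral_mul_const] at h1
    linear_combination (-1 / 2 : ℂ) * h1

/-- Parseval's identity. -/
theorem integral_norm_sq_trigPoly (Ω : Finset (Fin 3 → ℤ)) (c : (Fin 3 → ℤ) → ℂ) :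
    ∫ u in cube, ‖trigPoly Ω c u‖ ^ 2 = (2 * Real.pi) ^ 3 * ∑ q ∈ Ω, ‖c q‖ ^ 2 := by
  have h : ∀ u, ((‖trigPoly Ω c u‖ ^ 2 : ℝ) : ℂ) =
      ∑ q ∈ Ω, ∑ q' ∈ Ω, c q * (starRingEnd ℂ) (c q') * expChar (q - q') u := by
    intro u
    push_cast
    rw [← Complex.mul_conj', trigPoly, map_sum, Finset.sum_mul_sum]
    refine Finset.sum_congr rfl fun q _ => Finset.sum_congr rfl fun q' _ => ?_
    rw [map_mul, sub_eq_add_neg, expChar_add_freq, expChar_neg]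
    ring
  have hi : ∀ q q', Integrable (fun u => c q * (starRingEnd ℂ) (c q') * expChar (q - q') u)
      (volume.restrict cube) := fun q q' =>
    integrableOn_cube (continuous_const.mul (continuous_expChar _))
  have h2 : ((∫ u in cube, ‖trigPoly Ω c u‖ ^ 2 : ℝ) : ℂ) =
      (((2 * Real.pi) ^ 3 * ∑ q ∈ Ω, ‖c q‖ ^ 2 : ℝ) : ℂ) := by
    rw [← integral_complex_ofReal]
    simp only [h]
    rw [integral_finsetSum _ fun q _ => integrable_finsetSum _ fun q' _ => hi q q']
    push_cast
    rw [Finset.mul_sum]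
    refine Finset.sum_congr rfl fun q hq => ?_
    rw [integral_finsetSum _ fun q' _ => hi q q', Finset.sum_eq_single_of_mem q hq]
    · rw [integral_const_mul, integral_expChar, sub_self, if_pos rfl, Complex.mul_conj']
      push_cast; ring
    · intro q' _ hne
      rw [integral_const_mul, integral_expChar, if_neg (sub_ne_zero.2 hne.symm), mul_zero]
  exact_mod_cast h2

theorem lebesgueNorm_nonneg (Ω : Finset (Fin 3 → ℤ)) (c : (Fin 3 → ℤ) → ℂ) :
    0 ≤ lebesgueNorm Ω c := integral_nonneg fun _ => norm_nonneg _

/-- A finite linear combination, up to translations, of trigonometric polynomials. -/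
theorem lebesgueNorm_le_of_forall_eq_sum {ι : Type*} (S : Finset ι)
    (Ω : Finset (Fin 3 → ℤ)) (c : (Fin 3 → ℤ) → ℂ) (Ω' : ι → Finset (Fin 3 → ℤ))
    (d : ι → (Fin 3 → ℤ) → ℂ) (a : ι → ℂ) (v : ι → Fin 3 → ℝ)
    (h : ∀ u, trigPoly Ω c u = ∑ j ∈ S, a j * trigPoly (Ω' j) (d j) (u + v j)) :
    lebesgueNorm Ω c ≤ ∑ j ∈ S, ‖a j‖ * lebesgueNorm (Ω' j) (d j) := by
  have hc : ∀ j, Continuous fun u => ‖a j‖ * ‖trigPoly (Ω' j) (d j) (u + v j)‖ := fun j =>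
    continuous_const.mul ((continuous_trigPoly _ _).comp (continuous_id.add continuous_const)).norm
  calc lebesgueNorm Ω c
      ≤ ∫ u in cube, ∑ j ∈ S, ‖a j‖ * ‖trigPoly (Ω' j) (d j) (u + v j)‖ := by
        refine integral_mono (integrableOn_cube (continuous_trigPoly _ _).norm)
          (integrableOn_cube (continuous_finsetSum _ fun j _ => hc j)) fun u => ?_
        simp only [h u]
        exact (norm_sum_le _ _).trans (Finset.sum_le_sum fun j _ => (norm_mul _ _).le)
    _ = ∑ j ∈ S, ‖a j‖ * lebesgueNorm (Ω' j) (d j) := by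
        rw [integral_finsetSum _ fun j _ => integrableOn_cube (hc j)]
        refine Finset.sum_congr rfl fun j _ => ?_
        rw [integral_const_mul, integral_trigPoly_add continuous_norm]
        rfl

theorem lebesgueNorm_le_sum {ι : Type*} (S : Finset ι) (Ω : Finset (Fin 3 → ℤ))
    (c : (Fin 3 → ℤ) → ℂ) (d : ι → (Fin 3 → ℤ) → ℂ) (a : ι → ℂ)
    (h : ∀ q ∈ Ω, c q = ∑ j ∈ S, a j * d j q) :
    lebesgueNorm Ω c ≤ ∑ j ∈ S, ‖a j‖ * lebesgueNorm Ω (d j) := by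
  refine lebesgueNorm_le_of_forall_eq_sum S Ω c (fun _ => Ω) d a (fun _ => 0) fun u => ?_
  simp only [trigPoly, add_zero, Finset.mul_sum]
  rw [Finset.sum_comm]
  refine Finset.sum_congr rfl fun q hq => ?_
  rw [h q hq, Finset.sum_mul]
  exact Finset.sum_congr rfl fun j _ => by ring

theorem lebesgueNorm_congr {Ω : Finset (Fin 3 → ℤ)} {c c' : (Fin 3 → ℤ) → ℂ}
    (h : ∀ q ∈ Ω, c q = c' q) : lebesgueNorm Ω c = lebesgueNorm Ω c' := by
  unfold lebesgueNorm trigPoly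
  congr 1; ext u; congr 1
  exact Finset.sum_congr rfl fun q hq => by rw [h q hq]

/-- The Cauchy–Schwarz bound for the `L¹` norm of a product of two trigonometric polynomials. -/
theorem integral_norm_mul_trigPoly_le (A B : Finset (Fin 3 → ℤ)) (f g : (Fin 3 → ℤ) → ℂ)
    {T U : ℝ} (hT : 0 < T) (hU : 0 < U) (hf : ∀ q ∈ A, ‖f q‖ ≤ T) (hg : ∀ q ∈ B, ‖g q‖ ≤ U) :
    ∫ u in cube, ‖trigPoly A f u * trigPoly B g u‖ ≤
      (2 * Real.pi) ^ 3 * (T * U) * ((A.card + B.card) / 2) := by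
  have hbd : ∀ (A : Finset (Fin 3 → ℤ)) (f : (Fin 3 → ℤ) → ℂ) (T : ℝ), 0 < T →
      (∀ q ∈ A, ‖f q‖ ≤ T) → ∑ q ∈ A, ‖f q‖ ^ 2 ≤ A.card * T ^ 2 := by
    intro A f T _ hf
    rw [← nsmul_eq_mul]
    exact Finset.sum_le_card_nsmul _ _ _ fun q hq =>
      pow_le_pow_left₀ (norm_nonneg _) (hf q hq) 2
  have hcf : Continuous fun u => U / (2 * T) * ‖trigPoly A f u‖ ^ 2 :=
    continuous_const.mul ((continuous_trigPoly _ _).norm.pow 2)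
  have hcg : Continuous fun u => T / (2 * U) * ‖trigPoly B g u‖ ^ 2 :=
    continuous_const.mul ((continuous_trigPoly _ _).norm.pow 2)
  calc ∫ u in cube, ‖trigPoly A f u * trigPoly B g u‖
      ≤ ∫ u in cube, (U / (2 * T) * ‖trigPoly A f u‖ ^ 2 +
          T / (2 * U) * ‖trigPoly B g u‖ ^ 2) := by
        refine integral_mono
          (integrableOn_cube ((continuous_trigPoly _ _).mul (continuous_trigPoly _ _)).norm)
          (integrableOn_cube (hcf.add hcg)) fun u => ?_
        simp only [norm_mul]
        set x := ‖trigPoly A f u‖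
        set y := ‖trigPoly B g u‖
        -- Weighted AM-GM; the weights are chosen so that after Parseval each factor contributes `T
        -- * U / 2` per frequency.
        have : U / (2 * T) * x ^ 2 + T / (2 * U) * y ^ 2 - x * y =
            (U * x - T * y) ^ 2 / (2 * T * U) := by field_simp; ring
        have : 0 ≤ (U * x - T * y) ^ 2 / (2 * T * U) := by positivity
        linarith
    _ = U / (2 * T) * ((2 * Real.pi) ^ 3 * ∑ q ∈ A, ‖f q‖ ^ 2) +
          T / (2 * U) * ((2 * Real.pi) ^ 3 * ∑ q ∈ B, ‖g q‖ ^ 2) := by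
        rw [integral_add (integrableOn_cube hcf) (integrableOn_cube hcg), integral_const_mul,
          integral_const_mul, integral_norm_sq_trigPoly, integral_norm_sq_trigPoly]
    _ ≤ U / (2 * T) * ((2 * Real.pi) ^ 3 * (A.card * T ^ 2)) +
          T / (2 * U) * ((2 * Real.pi) ^ 3 * (B.card * U ^ 2)) := by
        gcongr
        · exact hbd A f T hT hf
        · exact hbd B g U hU hg
    _ = _ := by field_simp

/-! ### Cutting a spectrum with a rational half-space -/

/-- The denominator of the geometric sum is `2 sin (π x / T)`, which Jordan's inequality bounds
below by `4 min (x, T - x) / T`. Replacing the reciprocal of the minimum by a sum of reciprocals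
prepares two harmonic sums. -/
theorem norm_exp_geom_sum_le {T x : ℕ} (hx : 0 < x) (hxT : x < T) (J : ℕ) :
    ‖∑ j ∈ Finset.range J, Complex.exp (Complex.I * ((-(2 * Real.pi * x / T) : ℝ) : ℂ)) ^ j‖ ≤
      (T / 2 : ℝ) * (1 / x + 1 / (T - x)) := by
  set y := Complex.exp (Complex.I * ((-(2 * Real.pi * x / T) : ℝ) : ℂ)) with hy
  have hT : (0 : ℝ) < T := by exact_mod_cast hx.trans hxT
  have hx0 : (0 : ℝ) < x := by exact_mod_cast hx
  have hTx : (0 : ℝ) < T - x := by rw [sub_pos]; exact_mod_cast hxT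
  set θ := Real.pi * x / T with hθ
  have hy1 : ‖y - 1‖ = 2 * |Real.sin θ| := by
    rw [hy, Complex.norm_exp_I_mul_ofReal_sub_one, norm_mul, Real.norm_eq_abs, Real.norm_eq_abs,
      abs_two, show -(2 * Real.pi * x / T) / 2 = -θ by rw [hθ]; ring, Real.sin_neg, abs_neg]
  have hsin : 2 * min (x : ℝ) (T - x) / T ≤ Real.sin θ := by
    rcases le_total (2 * (x : ℝ)) T with h | h
    · have h1 : θ ≤ Real.pi / 2 := by
        rw [hθ, div_le_div_iff₀ hT two_pos]; nlinarith [Real.pi_pos]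
      have h2 := Real.mul_le_sin (by positivity : 0 ≤ θ) h1
      refine le_trans (le_of_eq ?_) h2
      rw [min_eq_left (by linarith), hθ]; field_simp
    · have h1 : Real.pi - θ ≤ Real.pi / 2 := by
        have : Real.pi / 2 ≤ θ := by
          rw [hθ, div_le_div_iff₀ two_pos hT]; nlinarith [Real.pi_pos]
        linarith
      have h0 : Real.pi - θ = Real.pi * (T - x) / T := by rw [hθ]; field_simp
      have h2 := Real.mul_le_sin (by rw [h0]; positivity : 0 ≤ Real.pi - θ) h1
      rw [Real.sin_pi_sub] at h2
      refine le_trans (le_of_eq ?_) h2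
      rw [min_eq_right (by linarith), h0]; field_simp
  have hmin : 0 < min (x : ℝ) (T - x) := lt_min hx0 hTx
  have hpos : 0 < 2 * min (x : ℝ) (T - x) / T := by positivity
  have hy1' : 2 * (2 * min (x : ℝ) (T - x) / T) ≤ ‖y - 1‖ := by
    rw [hy1, abs_of_pos (hpos.trans_le hsin)]; linarith
  have hyne : y ≠ 1 := fun h => by rw [h, sub_self, norm_zero] at hy1'; linarith
  have hynorm : ‖y‖ = 1 := by rw [hy, mul_comm, Complex.norm_exp_ofReal_mul_I]
  rw [geom_sum_eq hyne, norm_div]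
  have hnum : ‖y ^ J - 1‖ ≤ 2 := by
    refine (norm_sub_le _ _).trans ?_
    rw [norm_pow, hynorm, one_pow, norm_one]; norm_num
  calc ‖y ^ J - 1‖ / ‖y - 1‖ ≤ 2 / (2 * (2 * min (x : ℝ) (T - x) / T)) := by gcongr
    _ = T / 2 * (1 / min (x : ℝ) (T - x)) := by field_simp
    _ ≤ _ := by
      gcongr
      rcases min_choice (x : ℝ) (T - x) with h | h <;> rw [h]
      · have : 0 < 1 / ((T : ℝ) - x) := by positivity
        linarith
      · have : 0 < 1 / (x : ℝ) := by positivity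
        linarith

theorem sum_norm_exp_geom_sum_le (M J : ℕ) (hJ : J ≤ 2 * M + 1) :
    ∑ x ∈ Finset.range (2 * M + 1), ‖∑ j ∈ Finset.range J,
      Complex.exp (Complex.I * ((-(2 * Real.pi * x / (2 * M + 1 : ℕ)) : ℝ) : ℂ)) ^ j‖ ≤
      (2 * M + 1) * (2 + Real.log (2 * M + 1)) := by
  rw [Finset.sum_range_succ']
  have h0 : ‖∑ j ∈ Finset.range J, Complex.exp
      (Complex.I * ((-(2 * Real.pi * (0 : ℕ) / (2 * M + 1 : ℕ)) : ℝ) : ℂ)) ^ j‖ ≤ 2 * M + 1 := by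
    simp only [Nat.cast_zero, mul_zero, zero_div, neg_zero, Complex.ofReal_zero, Complex.exp_zero,
      one_pow, Finset.sum_const, Finset.card_range, nsmul_eq_mul, mul_one, Complex.norm_natCast]
    exact_mod_cast hJ
  have h1 : ∑ x ∈ Finset.range (2 * M), ‖∑ j ∈ Finset.range J, Complex.exp
      (Complex.I * ((-(2 * Real.pi * (x + 1 : ℕ) / (2 * M + 1 : ℕ)) : ℝ) : ℂ)) ^ j‖ ≤
      ∑ x ∈ Finset.range (2 * M), ((2 * M + 1 : ℕ) / 2 : ℝ) *
        (1 / (x + 1 : ℕ) + 1 / ((2 * M + 1 : ℕ) - (x + 1 : ℕ))) :=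
    Finset.sum_le_sum fun x hx =>
      norm_exp_geom_sum_le (Nat.succ_pos x) (by have := Finset.mem_range.1 hx; omega) J
  have h2 : ∑ x ∈ Finset.range (2 * M), (1 / (x + 1 : ℕ) : ℝ) = (harmonic (2 * M) : ℝ) := by
    rw [harmonic]; push_cast; simp
  have h3 : ∑ x ∈ Finset.range (2 * M), (1 / ((2 * M + 1 : ℕ) - (x + 1 : ℕ)) : ℝ) =
      (harmonic (2 * M) : ℝ) := by
    rw [← h2, ← Finset.sum_range_reflect]
    refine Finset.sum_congr rfl fun x hx => ?_
    have hx' := Finset.mem_range.1 hx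
    rw [← Nat.cast_sub (by omega)]
    congr 2
    omega
  rw [← Finset.mul_sum, Finset.sum_add_distrib, h2, h3] at h1
  have h4 : (harmonic (2 * M) : ℝ) ≤ 1 + Real.log (2 * M + 1) := by
    refine (harmonic_le_one_add_log _).trans ?_
    rcases Nat.eq_zero_or_pos M with rfl | hM
    · simp
    · have : (0 : ℝ) < M := by exact_mod_cast hM
      push_cast
      gcongr
      linarith
  push_cast at h1 h0 ⊢
  nlinarith [h1, h0, h4, (Nat.cast_nonneg M : (0 : ℝ) ≤ M)]

/-- Orthogonality of characters of `ℤ / T`: since `0 < |k - j| < T`, the ratio is a `T`-th root of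
unity other than `1`. -/
theorem sum_exp_pow_eq_zero {T k j : ℕ} (hk : k < T) (hj : j < T) (hkj : k ≠ j) :
    ∑ x ∈ Finset.range T, Complex.exp (2 * Real.pi * Complex.I * (((k : ℂ) - j) / T)) ^ x = 0 := by
  have hT : (T : ℂ) ≠ 0 := by exact_mod_cast (by omega : T ≠ 0)
  have hpi : (Real.pi : ℂ) ≠ 0 := by exact_mod_cast Real.pi_ne_zero
  have hne : Complex.exp (2 * Real.pi * Complex.I * (((k : ℂ) - j) / T)) ≠ 1 := by
    intro h
    obtain ⟨n, hn⟩ := Complex.exp_eq_one_iff.1 h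
    have h1 : ((k : ℂ) - j) = n * T := by
      have := Complex.I_ne_zero
      field_simp at hn
      linear_combination hn
    have h2 : (k : ℤ) - j = n * T := by exact_mod_cast h1
    have h3 : n = 0 := by
      by_contra h0
      have h4 : (T : ℤ) ≤ |n * T| := by
        rw [abs_mul, Nat.abs_cast]
        nlinarith [Int.one_le_abs h0, (Nat.cast_nonneg T : (0 : ℤ) ≤ T)]
      rw [← h2] at h4
      have := abs_lt.2 (⟨by omega, by omega⟩ : -(T : ℤ) < (k : ℤ) - j ∧ (k : ℤ) - j < T)
      omega
    rw [h3] at h2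
    omega
  rw [geom_sum_eq hne, ← Complex.exp_nat_mul]
  have : Complex.exp (T * (2 * Real.pi * Complex.I * (((k : ℂ) - j) / T))) = 1 := by
    rw [Complex.exp_eq_one_iff]
    exact ⟨(k : ℤ) - j, by push_cast; field_simp⟩
  rw [this, sub_self, zero_div]

/-- Restricting the spectrum to a half-space `{q | l · q ≤ b}` costs a logarithm of the number of
values of `l · q`. -/
theorem lebesgueNorm_halfSpace_le (Ω : Finset (Fin 3 → ℤ)) (c : (Fin 3 → ℤ) → ℂ)
    (l : Fin 3 → ℤ) (b : ℤ) (M : ℕ) (hM : ∀ q ∈ Ω, |l ⬝ᵥ q| ≤ M) :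
    lebesgueNorm Ω (fun q => if l ⬝ᵥ q ≤ b then c q else 0) ≤
      (2 + Real.log (2 * M + 1)) * lebesgueNorm Ω c := by
  set T : ℕ := 2 * M + 1 with hT
  have hT0 : (T : ℂ) ≠ 0 := by exact_mod_cast (by omega : T ≠ 0)
  -- With `k = l · q + M` in `[0, T)`, the half-space is `k < J`. Truncation by `toNat` and `min`
  -- covers thresholds `b` outside `[-M, M]`.
  set J : ℕ := min T (b + M + 1).toNat with hJ
  let y : ℕ → ℂ := fun x => Complex.exp (Complex.I * ((-(2 * Real.pi * x / T) : ℝ) : ℂ))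
  -- The discrete Fourier coefficients of the indicator of `k < J`; the factor with `M` undoes the
  -- shift from `l · q` to `k`.
  let a : ℕ → ℂ := fun x => (1 / T : ℂ) *
    Complex.exp (2 * Real.pi * Complex.I * (M * x / T)) * ∑ j ∈ Finset.range J, y x ^ j
  let v : ℕ → Fin 3 → ℝ := fun x i => (2 * Real.pi * x / T) * l i
  have hmain : ∀ u, trigPoly Ω (fun q => if l ⬝ᵥ q ≤ b then c q else 0) u =
      ∑ x ∈ Finset.range T, a x * trigPoly Ω c (u + v x) := by
    intro u
    simp only [trigPoly, Finset.mul_sum]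
    rw [Finset.sum_comm]
    refine Finset.sum_congr rfl fun q hq => ?_
    have hq' := abs_le.1 (hM q hq)
    obtain ⟨k, hk⟩ : ∃ k : ℕ, (k : ℤ) = l ⬝ᵥ q + M := ⟨(l ⬝ᵥ q + M).toNat, by omega⟩
    have hkT : k < T := by omega
    have hchar : ∀ x : ℕ, expChar q (v x) =
        Complex.exp (2 * Real.pi * Complex.I * (((k : ℂ) - M) * x / T)) := by
      intro x
      have h1 : (∑ i, (q i : ℝ) * v x i) = 2 * Real.pi * x / T * ((k : ℝ) - M) := by
        have h2 : (k : ℝ) = ((l ⬝ᵥ q : ℤ) : ℝ) + M := by exact_mod_cast congrArg (Int.cast (R := ℝ)) hk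
        rw [h2, dotProduct]
        push_cast
        simp only [v, Finset.mul_sum, add_sub_cancel_right]
        exact Finset.sum_congr rfl fun i _ => by ring
      rw [expChar, h1]
      congr 1
      push_cast
      ring
    have hterm : ∀ x j : ℕ, Complex.exp (2 * Real.pi * Complex.I * (M * x / T)) * y x ^ j *
        expChar q (v x) = Complex.exp (2 * Real.pi * Complex.I * (((k : ℂ) - j) / T)) ^ x := by
      intro x j
      simp only [hchar, y, ← Complex.exp_nat_mul, ← Complex.exp_add]
      congr 1
      push_cast
      ring
    have hsum : ∑ x ∈ Finset.range T, a x * expChar q (v x) = if l ⬝ᵥ q ≤ b then 1 else 0 := by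
      have h1 : ∀ x, a x * expChar q (v x) = (1 / T : ℂ) * ∑ j ∈ Finset.range J,
          Complex.exp (2 * Real.pi * Complex.I * (((k : ℂ) - j) / T)) ^ x := by
        intro x
        simp only [a, Finset.mul_sum, Finset.sum_mul]
        exact Finset.sum_congr rfl fun j _ => by rw [← hterm]; ring
      simp only [h1]
      rw [← Finset.mul_sum, Finset.sum_comm]
      split_ifs with hb
      · have hkJ : k ∈ Finset.range J := by rw [Finset.mem_range, hJ]; omega
        rw [Finset.sum_eq_single_of_mem k hkJ]
        · simp [hT0]
        · intro j hj hne
          exact sum_exp_pow_eq_zero hkT (by rw [Finset.mem_range, hJ] at hj; omega) hne.symm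
      · rw [Finset.sum_eq_zero, mul_zero]
        intro j hj
        rw [Finset.mem_range, hJ] at hj
        exact sum_exp_pow_eq_zero hkT (by omega) (by omega)
    have : ∀ x, a x * (c q * expChar q (u + v x)) = (a x * expChar q (v x)) * (c q * expChar q u) := by
      intro x; rw [expChar_add_point]; ring
    simp only [this]
    rw [← Finset.sum_mul, hsum]
    split_ifs <;> simp
  refine (lebesgueNorm_le_of_forall_eq_sum _ Ω _ (fun _ => Ω) (fun _ => c) a v hmain).trans ?_
  rw [← Finset.sum_mul]
  refine mul_le_mul_of_nonneg_right ?_ (lebesgueNorm_nonneg _ _)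
  have ha : ∀ x, ‖a x‖ = (1 / T : ℝ) * ‖∑ j ∈ Finset.range J, y x ^ j‖ := by
    intro x
    have h1 : ‖Complex.exp (2 * Real.pi * Complex.I * (M * x / T))‖ = 1 := by
      rw [show (2 * Real.pi * Complex.I * (M * x / T) : ℂ) =
        ((2 * Real.pi * (M * x / T) : ℝ) : ℂ) * Complex.I by push_cast; ring,
        Complex.norm_exp_ofReal_mul_I]
    simp only [a, norm_mul, h1, mul_one]
    congr 1
    simp
  simp only [ha]
  rw [← Finset.mul_sum]
  have h5 := sum_norm_exp_geom_sum_le M J (min_le_left _ _)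
  have hTr : (0 : ℝ) < T := by exact_mod_cast (by omega : 0 < T)
  have hTe : (T : ℝ) = 2 * M + 1 := by rw [hT]; push_cast; ring
  rw [one_div, inv_mul_le_iff₀ hTr, hTe]
  exact h5

/-! ### Intersections of many half-spaces -/

/-- `q` lies in the intersection of the half-spaces `{q | h.1 · q ≤ h.2}`, `h ∈ S`. -/
def MemHalfSpaces (S : Finset ((Fin 3 → ℤ) × ℤ)) (q : Fin 3 → ℤ) : Prop :=
  ∀ h ∈ S, h.1 ⬝ᵥ q ≤ h.2

open Classical in
/-- The part of a family of coefficients inside the half-spaces in `S`. -/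
def cutCoeff (S : Finset ((Fin 3 → ℤ) × ℤ)) (c : (Fin 3 → ℤ) → ℂ) (q : Fin 3 → ℤ) : ℂ :=
  if MemHalfSpaces S q then c q else 0

theorem lebesgueNorm_cutCoeff_le_pow (Ω : Finset (Fin 3 → ℤ)) (c : (Fin 3 → ℤ) → ℂ) (M : ℕ)
    (S : Finset ((Fin 3 → ℤ) × ℤ)) (hM : ∀ h ∈ S, ∀ q ∈ Ω, |h.1 ⬝ᵥ q| ≤ M) :
    lebesgueNorm Ω (cutCoeff S c) ≤
      (2 + Real.log (2 * M + 1)) ^ S.card * lebesgueNorm Ω c := by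
  classical
  induction S using Finset.induction_on with
  | empty =>
    rw [Finset.card_empty, pow_zero, one_mul]
    refine (lebesgueNorm_congr fun q _ => ?_).le
    simp [cutCoeff, MemHalfSpaces]
  | insert h S hS ih =>
    have h1 : lebesgueNorm Ω (cutCoeff (insert h S) c) =
        lebesgueNorm Ω (fun q => if h.1 ⬝ᵥ q ≤ h.2 then cutCoeff S c q else 0) := by
      refine lebesgueNorm_congr fun q _ => ?_
      simp only [cutCoeff, MemHalfSpaces, Finset.forall_mem_insert, ite_and]
      congr
    rw [h1, Finset.card_insert_of_notMem hS, pow_succ', mul_assoc]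
    have hlog : 0 ≤ 2 + Real.log (2 * M + 1) := by
      have := Real.log_nonneg (by linarith [(Nat.cast_nonneg M : (0 : ℝ) ≤ M)] :
        (1 : ℝ) ≤ 2 * M + 1)
      linarith
    exact (lebesgueNorm_halfSpace_le Ω _ h.1 h.2 M (hM h (Finset.mem_insert_self _ _))).trans
      (mul_le_mul_of_nonneg_left
        (ih fun h' hh' => hM h' (Finset.mem_insert_of_mem hh')) hlog)

/-- Among four half-spaces in dimension three, there are some whose complements have no point in
common with the remaining ones. -/
theorem exists_infeasible_sign_pattern (T : Finset ((Fin 3 → ℤ) × ℤ)) (hT : T.card = 4) :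
    ∃ I ⊆ T, ∀ q : Fin 3 → ℤ, MemHalfSpaces (T \ I) q → ¬ ∀ h ∈ I, h.2 < h.1 ⬝ᵥ q := by
  classical
  let f : T → Fin 3 → ℝ := fun h i => (h.1.1 i : ℝ)
  have hdep : ¬ LinearIndependent ℝ f := by
    intro h
    have := h.fintype_card_le_finrank
    simp [hT] at this
  obtain ⟨g, hg, i0, hi0⟩ := Fintype.not_linearIndependent_iff.1 hdep
  -- Up to sign, the dependence `g` pairs nonnegatively with the thresholds, and has a positive
  -- entry if the pairing is zero. Violating the constraints with `g > 0` and satisfying the others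
  -- would force `0 = ∑ g (l · q) ≥ ∑ g b ≥ 0` with one inequality strict.
  obtain ⟨g, hg, hgb⟩ : ∃ g : T → ℝ, ∑ h, g h • f h = 0 ∧
      (0 < ∑ h, g h * (h.1.2 : ℝ) ∨ 0 = ∑ h, g h * (h.1.2 : ℝ) ∧ ∃ i, 0 < g i) := by
    have hneg : ∑ h, (-g) h • f h = 0 := by
      simp only [Pi.neg_apply, neg_smul, Finset.sum_neg_distrib, hg, neg_zero]
    have hneg' : ∑ h, (-g) h * (h.1.2 : ℝ) = -∑ h, g h * (h.1.2 : ℝ) := by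
      simp only [Pi.neg_apply, neg_mul, Finset.sum_neg_distrib]
    rcases lt_trichotomy 0 (∑ h, g h * (h.1.2 : ℝ)) with h | h | h
    · exact ⟨g, hg, Or.inl h⟩
    · rcases lt_or_gt_of_ne hi0 with h' | h'
      · exact ⟨-g, hneg, Or.inr ⟨by rw [hneg', ← h, neg_zero], i0, by simpa using h'⟩⟩
      · exact ⟨g, hg, Or.inr ⟨h, i0, h'⟩⟩
    · exact ⟨-g, hneg, Or.inl (by rw [hneg']; linarith)⟩
  refine ⟨(Finset.univ.filter fun h : T => 0 < g h).map (Function.Embedding.subtype _), ?_, ?_⟩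
  · intro x hx
    obtain ⟨y, _, rfl⟩ := Finset.mem_map.1 hx
    exact y.2
  · intro q hq hq'
    have hin : ∀ h : T, 0 < g h → (h.1.2 : ℝ) < ((h.1.1 ⬝ᵥ q : ℤ) : ℝ) := fun h hh => by
      exact_mod_cast hq' h (Finset.mem_map.2 ⟨h, by simpa using hh, rfl⟩)
    have hout : ∀ h : T, g h ≤ 0 → ((h.1.1 ⬝ᵥ q : ℤ) : ℝ) ≤ (h.1.2 : ℝ) := fun h hh => by
      refine mod_cast hq h (Finset.mem_sdiff.2 ⟨h.2, fun hmem => ?_⟩)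
      obtain ⟨y, hy, hyh⟩ := Finset.mem_map.1 hmem
      have : y = h := Subtype.ext hyh
      rw [this] at hy
      exact absurd (Finset.mem_filter.1 hy).2 (not_lt.2 hh)
    have hzero : ∑ h : T, g h * ((h.1.1 ⬝ᵥ q : ℤ) : ℝ) = 0 := by
      have h1 : ∀ i, ∑ h : T, g h * (h.1.1 i : ℝ) = 0 := fun i => by
        simpa [f, Finset.sum_apply] using congrFun hg i
      simp only [dotProduct, Int.cast_sum, Int.cast_mul, Finset.mul_sum]
      rw [Finset.sum_comm]
      refine Finset.sum_eq_zero fun i _ => ?_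
      simp only [← mul_assoc]
      rw [← Finset.sum_mul, h1, zero_mul]
    have hle : ∀ h ∈ (Finset.univ : Finset T),
        g h * (h.1.2 : ℝ) ≤ g h * ((h.1.1 ⬝ᵥ q : ℤ) : ℝ) := fun h _ => by
      rcases le_or_gt (g h) 0 with hh | hh
      · exact mul_le_mul_of_nonpos_left (hout h hh) hh
      · exact mul_le_mul_of_nonneg_left (hin h hh).le hh.le
    rcases hgb with h | ⟨h, i, hi⟩
    · have := Finset.sum_le_sum hle
      linarith
    · have := Finset.sum_lt_sum hle ⟨i, Finset.mem_univ _, mul_lt_mul_of_pos_left (hin i hi) hi⟩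
      linarith

/-- With `x h` the indicator of a half-space, infeasibility says `∏_{S \ I} x h * ∏_I (x h - 1) =
0`. Expanding the second product and solving for the term `V = ∅` gives the formula; if `I` is
empty, it says that the cut is zero. -/
theorem cutCoeff_eq_sum_of_infeasible (S I : Finset ((Fin 3 → ℤ) × ℤ)) (hIS : I ⊆ S)
    (hI : ∀ q : Fin 3 → ℤ, MemHalfSpaces (S \ I) q → ¬ ∀ h ∈ I, h.2 < h.1 ⬝ᵥ q)
    (c : (Fin 3 → ℤ) → ℂ) (q : Fin 3 → ℤ) :
    cutCoeff S c q = ∑ V ∈ I.powerset.erase ∅, (-1) ^ (V.card + 1) * cutCoeff (S \ V) c q := by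
  classical
  let x : (Fin 3 → ℤ) × ℤ → ℂ := fun h => if h.1 ⬝ᵥ q ≤ h.2 then 1 else 0
  have hprod : ∀ S : Finset ((Fin 3 → ℤ) × ℤ), cutCoeff S c q = (∏ h ∈ S, x h) * c q := by
    intro S
    unfold cutCoeff
    split_ifs with h
    · rw [Finset.prod_eq_one fun h' hh' => if_pos (h h' hh'), one_mul]
    · simp only [MemHalfSpaces, not_forall] at h
      obtain ⟨h', hh', hlt⟩ := h
      rw [Finset.prod_eq_zero hh' (if_neg hlt), zero_mul]
  have hsplit : ∀ V ∈ I.powerset, cutCoeff (S \ V) c q =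
      (∏ h ∈ S \ I, x h) * (∏ h ∈ I \ V, x h) * c q := by
    intro V hV
    have hVI := Finset.mem_powerset.1 hV
    rw [hprod, ← Finset.prod_sdiff (Finset.sdiff_subset_sdiff (Finset.Subset.refl S) hVI
      |>.trans_eq rfl : S \ I ⊆ S \ V), mul_comm (∏ h ∈ S \ I, x h)]
    congr 3
    ext h
    simp only [Finset.mem_sdiff]
    constructor
    · rintro ⟨⟨h1, h2⟩, h3⟩
      exact ⟨by_contra fun h4 => h3 ⟨h1, h4⟩, h2⟩
    · rintro ⟨h1, h2⟩
      exact ⟨⟨hIS h1, h2⟩, fun h3 => h3.2 h1⟩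
  have hzero : ∑ V ∈ I.powerset, (-1) ^ V.card * cutCoeff (S \ V) c q = 0 := by
    rw [Finset.sum_congr rfl fun V hV => by rw [hsplit V hV]]
    have hexp : ∏ h ∈ I, (-1 + x h) = ∑ V ∈ I.powerset, (-1) ^ V.card * ∏ h ∈ I \ V, x h := by
      rw [Finset.prod_add]
      simp
    have : ∑ V ∈ I.powerset, (-1) ^ V.card * ((∏ h ∈ S \ I, x h) * (∏ h ∈ I \ V, x h) * c q) =
        (∏ h ∈ S \ I, x h) * (∏ h ∈ I, (-1 + x h)) * c q := by
      rw [hexp, Finset.mul_sum, Finset.sum_mul]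
      exact Finset.sum_congr rfl fun V _ => by ring
    rw [this]
    by_cases hq : MemHalfSpaces (S \ I) q
    · have := hI q hq
      push Not at this
      obtain ⟨h, hh, hle⟩ := this
      rw [Finset.prod_eq_zero (i := h) hh (by simp [x, hle])]
      simp
    · simp only [MemHalfSpaces, not_forall] at hq
      obtain ⟨h', hh', hlt⟩ := hq
      rw [Finset.prod_eq_zero hh' (if_neg hlt)]
      simp
  rw [← Finset.add_sum_erase _ _ (Finset.empty_mem_powerset I)] at hzero
  simp only [Finset.card_empty, pow_zero, one_mul, Finset.sdiff_empty] at hzero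
  rw [eq_neg_of_add_eq_zero_left hzero, ← Finset.sum_neg_distrib]
  exact Finset.sum_congr rfl fun V _ => by ring

/-- Restricting the spectrum to an intersection of half-spaces costs three logarithms, up to a
factor that depends only on the number of half-spaces. -/
theorem lebesgueNorm_cutCoeff_le (Ω : Finset (Fin 3 → ℤ)) (c : (Fin 3 → ℤ) → ℂ) (M : ℕ)
    (S : Finset ((Fin 3 → ℤ) × ℤ)) (hM : ∀ h ∈ S, ∀ q ∈ Ω, |h.1 ⬝ᵥ q| ≤ M) :
    lebesgueNorm Ω (cutCoeff S c) ≤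
      16 ^ S.card * ((2 + Real.log (2 * M + 1)) ^ 3 * lebesgueNorm Ω c) := by
  classical
  have hlog : 0 ≤ Real.log (2 * M + 1) :=
    Real.log_nonneg (by linarith [(Nat.cast_nonneg M : (0 : ℝ) ≤ M)])
  have hB : 0 ≤ (2 + Real.log (2 * M + 1)) ^ 3 * lebesgueNorm Ω c :=
    mul_nonneg (by positivity) (lebesgueNorm_nonneg _ _)
  induction hn : S.card using Nat.strong_induction_on generalizing S with
  | _ n ih =>
    -- Up to three half-spaces are cut one by one, one logarithm each. From four on, every term of
    -- the expansion has fewer half-spaces and there are at most `2 ^ 4` terms, hence the factor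
    -- `16` per step.
    rcases Nat.lt_or_ge n 4 with h4 | h4
    · refine (lebesgueNorm_cutCoeff_le_pow Ω c M S hM).trans ?_
      have h1 : (2 + Real.log (2 * M + 1)) ^ S.card ≤ (2 + Real.log (2 * M + 1)) ^ 3 :=
        pow_le_pow_right₀ (by linarith) (by omega)
      refine (mul_le_mul_of_nonneg_right h1 (lebesgueNorm_nonneg _ _)).trans ?_
      exact le_mul_of_one_le_left hB (one_le_pow₀ (by norm_num))
    · obtain ⟨T, hTS, hT⟩ := Finset.exists_subset_card_eq (hn ▸ h4)
      obtain ⟨I, hIT, hI⟩ := exists_infeasible_sign_pattern T hT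
      have hI' : ∀ q : Fin 3 → ℤ, MemHalfSpaces (S \ I) q → ¬ ∀ h ∈ I, h.2 < h.1 ⬝ᵥ q :=
        fun q hq => hI q fun h hh => hq h (Finset.sdiff_subset_sdiff hTS (Finset.Subset.refl I) hh)
      refine (lebesgueNorm_le_sum (I.powerset.erase ∅) Ω _ _ _ fun q _ =>
        cutCoeff_eq_sum_of_infeasible S I (hIT.trans hTS) hI' c q).trans ?_
      have hcard : (I.powerset.erase ∅).card ≤ 16 := by
        refine (Finset.card_erase_le).trans ?_
        rw [Finset.card_powerset]
        calc 2 ^ I.card ≤ 2 ^ 4 := Nat.pow_le_pow_right (by norm_num)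
              (hT ▸ Finset.card_le_card hIT)
          _ = 16 := by norm_num
      calc _ ≤ ∑ V ∈ I.powerset.erase ∅,
            16 ^ (n - 1) * ((2 + Real.log (2 * M + 1)) ^ 3 * lebesgueNorm Ω c) := by
            refine Finset.sum_le_sum fun V hV => ?_
            obtain ⟨hV0, hVI⟩ := Finset.mem_erase.1 hV
            have hVS : V ⊆ S := (Finset.mem_powerset.1 hVI).trans (hIT.trans hTS)
            have hVpos : 0 < V.card := Finset.card_pos.2 (Finset.nonempty_iff_ne_empty.2 hV0)
            have hle := Finset.card_le_card hVS
            have hc := Finset.card_sdiff_of_subset hVS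
            rw [norm_pow, norm_neg, norm_one, one_pow, one_mul]
            refine (ih _ (by omega) (S \ V)
              (fun h hh => hM h (Finset.sdiff_subset hh)) rfl).trans ?_
            exact mul_le_mul_of_nonneg_right
              (pow_le_pow_right₀ (by norm_num) (by omega)) hB
        _ ≤ 16 * (16 ^ (n - 1) * ((2 + Real.log (2 * M + 1)) ^ 3 * lebesgueNorm Ω c)) := by
            rw [Finset.sum_const, nsmul_eq_mul]
            refine mul_le_mul_of_nonneg_right (by exact_mod_cast hcard) (by positivity)
        _ = _ := by
            rw [← mul_assoc, ← pow_succ']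
            congr 2
            omega

/-! ### Kernels that reproduce a weight on a cube of frequencies -/

/-- The frequencies all of whose coordinates are at most `n` in absolute value. -/
def freqBox (n : ℕ) : Finset (Fin 3 → ℤ) := Finset.Icc (fun _ => -(n : ℤ)) (fun _ => (n : ℤ))

theorem mem_freqBox {n : ℕ} {q : Fin 3 → ℤ} : q ∈ freqBox n ↔ ∀ i, |q i| ≤ n := by
  simp only [freqBox, Finset.mem_Icc, Pi.le_def, abs_le, forall_and]

theorem card_freqBox (n : ℕ) : (freqBox n).card = (2 * n + 1) ^ 3 := by
  rw [freqBox, Pi.card_Icc]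
  simp only [Int.card_Icc, Finset.prod_const, Finset.card_univ, Fintype.card_fin]
  congr 1
  omega

/-- The coefficients of the product of two trigonometric polynomials. -/
def convCoeff (A B : Finset (Fin 3 → ℤ)) (f g : (Fin 3 → ℤ) → ℂ) (q : Fin 3 → ℤ) : ℂ :=
  ∑ p ∈ (A ×ˢ B).filter (fun p => p.1 + p.2 = q), f p.1 * g p.2

theorem trigPoly_convCoeff (A B Ω : Finset (Fin 3 → ℤ)) (f g : (Fin 3 → ℤ) → ℂ)
    (h : ∀ a ∈ A, ∀ b ∈ B, a + b ∈ Ω) (u : Fin 3 → ℝ) :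
    trigPoly Ω (convCoeff A B f g) u = trigPoly A f u * trigPoly B g u := by
  simp only [trigPoly, convCoeff]
  rw [Finset.sum_mul_sum, ← Finset.sum_product',
    ← Finset.sum_fiberwise_of_maps_to (s := A ×ˢ B) (t := Ω) (g := fun p => p.1 + p.2)
      fun p hp => h _ (Finset.mem_product.1 hp).1 _ (Finset.mem_product.1 hp).2]
  refine Finset.sum_congr rfl fun q _ => ?_
  rw [Finset.sum_mul]
  refine Finset.sum_congr rfl fun p hp => ?_
  rw [← (Finset.mem_filter.1 hp).2, expChar_add_freq]
  ring

/-- The larger box has at most `8 (2B + 1)³` points, so the mean of the two cardinalities in the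
Cauchy–Schwarz bound is at most `5 (2B + 1)³`. -/
theorem lebesgueNorm_convCoeff_le (B : ℕ) (f g : (Fin 3 → ℤ) → ℂ) {T U : ℝ} (hT : 0 < T)
    (hU : 0 < U) (hf : ∀ q ∈ freqBox (2 * B), ‖f q‖ ≤ T) (hg : ∀ q ∈ freqBox B, ‖g q‖ ≤ U) :
    lebesgueNorm (freqBox (3 * B)) (convCoeff (freqBox (2 * B)) (freqBox B) f g) ≤
      5 * (2 * Real.pi) ^ 3 * (T * U) * (2 * B + 1) ^ 3 := by
  have hmem : ∀ a ∈ freqBox (2 * B), ∀ b ∈ freqBox B, a + b ∈ freqBox (3 * B) := by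
    intro a ha b hb
    rw [mem_freqBox] at *
    intro i
    have h1 := ha i
    have h2 := hb i
    have := abs_add_le (a i) (b i)
    simp only [Pi.add_apply]
    push_cast at *
    linarith
  have h1 := integral_norm_mul_trigPoly_le (freqBox (2 * B)) (freqBox B) f g hT hU hf hg
  rw [lebesgueNorm]
  simp only [trigPoly_convCoeff _ _ _ f g hmem]
  refine h1.trans ?_
  rw [card_freqBox, card_freqBox]
  push_cast
  have hB : (0 : ℝ) ≤ B := Nat.cast_nonneg B
  have h2 : ((2 * (2 * (B : ℝ)) + 1) ^ 3 + (2 * B + 1) ^ 3) / 2 ≤ 5 * (2 * B + 1) ^ 3 := by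
    have : (2 * (2 * (B : ℝ)) + 1) ^ 3 ≤ (2 * (2 * B + 1)) ^ 3 := by gcongr; linarith
    have h3 : (0 : ℝ) ≤ (2 * B + 1) ^ 3 := by positivity
    rw [mul_pow] at this
    linarith
  calc _ ≤ (2 * Real.pi) ^ 3 * (T * U) * (5 * (2 * B + 1) ^ 3) := by gcongr
    _ = _ := by ring

/-- If `t (a + b)` is a sum of products of functions of `a` and of `b`, the weight `t` on a cube is
reproduced by a trigonometric polynomial with controlled `L¹` norm. -/
theorem exists_kernel_of_split {ι : Type*} (B : ℕ) (S : Finset ι) (t : (Fin 3 → ℤ) → ℝ)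
    (f g : ι → (Fin 3 → ℤ) → ℝ) (T U : ι → ℝ) (hT : ∀ j, 0 < T j) (hU : ∀ j, 0 < U j)
    (hf : ∀ j, ∀ q ∈ freqBox (2 * B), |f j q| ≤ T j) (hg : ∀ j, ∀ q ∈ freqBox B, |g j q| ≤ U j)
    (ht : ∀ a b, t (a + b) = ∑ j ∈ S, f j a * g j b) :
    ∃ c : (Fin 3 → ℤ) → ℂ, (∀ q ∈ freqBox B, c q = t q) ∧
      lebesgueNorm (freqBox (3 * B)) c ≤ 5 * (2 * Real.pi) ^ 3 * ∑ j ∈ S, T j * U j := by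
  set W : ℝ := (2 * B + 1) ^ 3 with hW
  have hW0 : 0 < W := by positivity
  let d : ι → (Fin 3 → ℤ) → ℂ := fun j =>
    convCoeff (freqBox (2 * B)) (freqBox B) (fun q => (f j q : ℂ)) (fun q => (g j q : ℂ))
  refine ⟨fun q => ∑ j ∈ S, ((W⁻¹ : ℝ) : ℂ) * d j q, fun q hq => ?_, ?_⟩
  · have h1 : ∑ j ∈ S, d j q = ∑ p ∈ (freqBox (2 * B) ×ˢ freqBox B).filter
        (fun p => p.1 + p.2 = q), (t q : ℂ) := by
      simp only [d, convCoeff]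
      rw [Finset.sum_comm]
      refine Finset.sum_congr rfl fun p hp => ?_
      rw [← (Finset.mem_filter.1 hp).2, ht]
      push_cast
      rfl
    -- For `q` in the box of size `B`, every `b` in that box leaves `q - b` in the box of size `2B`;
    -- the number of representations is thus independent of `q`, and `W` normalizes it.
    have h2 : ((freqBox (2 * B) ×ˢ freqBox B).filter (fun p => p.1 + p.2 = q)).card =
        (2 * B + 1) ^ 3 := by
      rw [← card_freqBox]
      refine Finset.card_bij' (fun p _ => p.2) (fun b _ => (q - b, b)) ?_ ?_ ?_ ?_
      · intro p hp
        exact (Finset.mem_product.1 (Finset.mem_filter.1 hp).1).2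
      · intro b hb
        refine Finset.mem_filter.2 ⟨Finset.mem_product.2 ⟨?_, hb⟩, sub_add_cancel _ _⟩
        rw [mem_freqBox] at *
        intro i
        have := abs_sub (q i) (b i)
        have h1 := hq i
        have h2 := hb i
        simp only [Pi.sub_apply]
        push_cast
        linarith
      · rintro ⟨a, b⟩ hp
        have := (Finset.mem_filter.1 hp).2
        simp only [← this, add_sub_cancel_right]
      · intro b _
        rfl
    beta_reduce
    rw [← Finset.mul_sum, h1, Finset.sum_const, h2, nsmul_eq_mul, ← mul_assoc]
    have : ((W⁻¹ : ℝ) : ℂ) * (((2 * B + 1) ^ 3 : ℕ) : ℂ) = 1 := by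
      rw [show (((2 * B + 1) ^ 3 : ℕ) : ℂ) = (W : ℂ) by rw [hW]; push_cast; ring,
        ← Complex.ofReal_mul, inv_mul_cancel₀ hW0.ne', Complex.ofReal_one]
    rw [this, one_mul]
  · refine (lebesgueNorm_le_sum S _ _ d (fun _ => ((W⁻¹ : ℝ) : ℂ)) fun q _ => rfl).trans ?_
    rw [Finset.mul_sum]
    refine Finset.sum_le_sum fun j _ => ?_
    rw [Complex.norm_real, Real.norm_eq_abs, abs_of_pos (inv_pos.2 hW0), inv_mul_le_iff₀ hW0]
    refine (lebesgueNorm_convCoeff_le B _ _ (hT j) (hU j) (fun q hq => ?_)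
      (fun q hq => ?_)).trans (le_of_eq (by ring))
    · rw [Complex.norm_real]; exact hf j q hq
    · rw [Complex.norm_real]; exact hg j q hq

theorem abs_coord_le_of_mem_freqBox {n : ℕ} {q : Fin 3 → ℤ} (hq : q ∈ freqBox n) (i : Fin 3) :
    |(q i : ℝ)| ≤ n := by
  exact_mod_cast mem_freqBox.1 hq i

theorem exists_kernel_coord {B : ℕ} (hB : 0 < B) (μ : Fin 3) :
    ∃ c : (Fin 3 → ℤ) → ℂ, (∀ q ∈ freqBox B, c q = ((q μ : ℝ) : ℂ)) ∧
      lebesgueNorm (freqBox (3 * B)) c ≤ 15 * (2 * Real.pi) ^ 3 * B := by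
  have hB' : (0 : ℝ) < B := by exact_mod_cast hB
  obtain ⟨c, hc, hle⟩ := exists_kernel_of_split B Finset.univ (fun q => (q μ : ℝ))
    ![fun a => (a μ : ℝ), fun _ => 1] ![fun _ => 1, fun b => (b μ : ℝ)]
    ![2 * B, 1] ![1, B]
    (by simp [Fin.forall_fin_two, hB']) (by simp [Fin.forall_fin_two, hB'])
    (by
      simp only [Fin.forall_fin_two, Matrix.cons_val_zero, Matrix.cons_val_one]
      refine ⟨fun q hq => ?_, by simp⟩
      exact_mod_cast abs_coord_le_of_mem_freqBox hq μ)
    (by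
      simp only [Fin.forall_fin_two, Matrix.cons_val_zero, Matrix.cons_val_one]
      exact ⟨by simp, fun q hq => abs_coord_le_of_mem_freqBox hq μ⟩)
    (by intro a b; simp [Fin.sum_univ_two])
  refine ⟨c, hc, hle.trans (le_of_eq ?_)⟩
  simp only [Fin.sum_univ_two, Matrix.cons_val_zero, Matrix.cons_val_one]
  ring

theorem exists_kernel_coord_mul {B : ℕ} (hB : 0 < B) (μ ν : Fin 3) :
    ∃ c : (Fin 3 → ℤ) → ℂ, (∀ q ∈ freqBox B, c q = (((q μ : ℝ) * (q ν : ℝ) : ℝ) : ℂ)) ∧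
      lebesgueNorm (freqBox (3 * B)) c ≤ 45 * (2 * Real.pi) ^ 3 * B ^ 2 := by
  have hB' : (0 : ℝ) < B := by exact_mod_cast hB
  have h2 : ∀ q ∈ freqBox (2 * B), ∀ i, |(q i : ℝ)| ≤ 2 * B := fun q hq i => by
    exact_mod_cast abs_coord_le_of_mem_freqBox hq i
  have h1 : ∀ q ∈ freqBox B, ∀ i, |(q i : ℝ)| ≤ B := fun q hq i =>
    abs_coord_le_of_mem_freqBox hq i
  -- Expand `(a μ + b μ) * (a ν + b ν)`; the four products are bounded by `(4 + 2 + 2 + 1) B² = 9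
  -- B²`.
  obtain ⟨c, hc, hle⟩ := exists_kernel_of_split B Finset.univ (fun q => (q μ : ℝ) * (q ν : ℝ))
    ![fun a => (a μ : ℝ) * (a ν : ℝ), fun a => (a μ : ℝ), fun a => (a ν : ℝ), fun _ => 1]
    ![fun _ => 1, fun b => (b ν : ℝ), fun b => (b μ : ℝ), fun b => (b μ : ℝ) * (b ν : ℝ)]
    ![(2 * B) * (2 * B), 2 * B, 2 * B, 1] ![1, B, B, B * B]
    (by intro j; fin_cases j <;> simp [hB']) (by intro j; fin_cases j <;> simp [hB'])
    (by
      intro j q hq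
      have hμ := h2 q hq μ
      have hν := h2 q hq ν
      fin_cases j
      · simpa [abs_mul] using mul_le_mul hμ hν (abs_nonneg _) (by positivity)
      · simpa using hμ
      · simpa using hν
      · simp)
    (by
      intro j q hq
      have hμ := h1 q hq μ
      have hν := h1 q hq ν
      fin_cases j
      · simp
      · simpa using hν
      · simpa using hμ
      · simpa [abs_mul] using mul_le_mul hμ hν (abs_nonneg _) (by positivity))
    (by intro a b; simp [Fin.sum_univ_four]; ring)
  refine ⟨c, hc, hle.trans (le_of_eq ?_)⟩
  simp [Fin.sum_univ_four]
  ring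

/-! ### Facets of a polytope through extreme points of its polar -/

/-- The polar of the convex hull of the points `w l`. -/
def polarSet {ι : Type*} (w : ι → E3) : Set E3 := {n | ∀ l, inner ℝ n (w l) ≤ 1}

theorem isClosed_polarSet {ι : Type*} (w : ι → E3) : IsClosed (polarSet w) := by
  rw [polarSet, Set.ofPred_forall]
  exact isClosed_iInter fun l => isClosed_le (by fun_prop) continuous_const

theorem exists_mem_polarSet_one_lt {ι : Type*} [Finite ι] (w : ι → E3)
    (hb : ∀ n ∈ polarSet w, ‖n‖ ≤ 2) {x : E3} (hx : x ∉ convexHull ℝ (Set.range w)) :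
    ∃ n ∈ polarSet w, 1 < inner ℝ n x := by
  have hclosed : IsClosed (convexHull ℝ (Set.range w)) :=
    ((Set.finite_range w).isCompact_convexHull ℝ).isClosed
  obtain ⟨f, u, hfu, hux⟩ := geometric_hahn_banach_closed_point (convex_convexHull ℝ _) hclosed hx
  obtain ⟨y, rfl⟩ := (InnerProductSpace.toDual ℝ E3).surjective f
  simp only [InnerProductSpace.toDual_apply_apply] at hfu hux
  have hw : ∀ l, inner ℝ y (w l) < u := fun l => hfu _ (subset_convexHull ℝ _ ⟨l, rfl⟩)
  -- If `u ≤ 0`, the whole ray through `y` lies in the polar, against its boundedness. A family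
  -- without points is excluded in the same way, its polar being the whole space.
  have hu : 0 < u := by
    by_contra hu
    push Not at hu
    have hmem : ∀ t : ℝ, 0 ≤ t → t • y ∈ polarSet w := fun t ht l => by
      rw [real_inner_smul_left]
      have : t * inner ℝ y (w l) ≤ 0 := mul_nonpos_of_nonneg_of_nonpos ht ((hw l).le.trans hu)
      linarith
    have hy : y = 0 := by
      by_contra hy
      have hpos : 0 < ‖y‖ := norm_pos_iff.2 hy
      have := hb _ (hmem (3 / ‖y‖) (by positivity))
      rw [norm_smul, Real.norm_eq_abs, abs_of_pos (by positivity), div_mul_cancel₀ _ hpos.ne']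
        at this
      linarith
    by_cases hne : Nonempty ι
    · obtain ⟨l⟩ := hne
      have h1 := hw l
      rw [hy, inner_zero_left] at h1 hux
      linarith
    · have h3 : EuclideanSpace.single (0 : Fin 3) (3 : ℝ) ∈ polarSet w :=
        fun l => absurd ⟨l⟩ hne
      have := hb _ h3
      simp only [PiLp.norm_single, Real.norm_eq_abs] at this
      norm_num at this
  refine ⟨u⁻¹ • y, fun l => ?_, ?_⟩
  · rw [real_inner_smul_left, inv_mul_le_iff₀ hu, mul_one]
    exact (hw l).le
  · rw [real_inner_smul_left, lt_inv_mul_iff₀ hu, mul_one]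
    exact hux

/-- At an extreme point of the polar, three linearly independent constraints are tight. -/
theorem exists_linearIndependent_tight {ι : Type*} [Finite ι] (w : ι → E3) {n : E3}
    (hn : n ∈ (polarSet w).extremePoints ℝ) :
    ∃ τ : Fin 3 → ι, LinearIndependent ℝ (fun i => w (τ i)) ∧ ∀ i, inner ℝ n (w (τ i)) = 1 := by
  -- If the tight corners did not span, `n` could be moved both ways along a vector orthogonal to
  -- them: tight constraints stay tight and the finitely many others have slack. This contradicts
  -- extremality.
  have hspan : Submodule.span ℝ (w '' {l | inner ℝ n (w l) = 1}) = ⊤ := by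
    by_contra hne
    have hperp : (Submodule.span ℝ (w '' {l | inner ℝ n (w l) = 1}))ᗮ ≠ ⊥ := fun h =>
      hne ((Submodule.orthogonal_eq_bot_iff).1 h)
    obtain ⟨v, hv, hv0⟩ := Submodule.exists_mem_ne_zero_of_ne_bot hperp
    have hv' : ∀ l, inner ℝ n (w l) = 1 → inner ℝ v (w l) = 0 := fun l hl =>
      Submodule.inner_left_of_mem_orthogonal (Submodule.subset_span (Set.mem_image_of_mem w hl)) hv
    obtain ⟨ε, hε, hεl⟩ : ∃ ε : ℝ, 0 < ε ∧ ∀ l, inner ℝ n (w l) + ε * |inner ℝ v (w l)| ≤ 1 := by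
      have h1 : ∀ l, ∃ ε : ℝ, 0 < ε ∧ ∀ δ, 0 < δ → δ ≤ ε →
          inner ℝ n (w l) + δ * |inner ℝ v (w l)| ≤ 1 := by
        intro l
        rcases eq_or_lt_of_le (hn.1 l) with h | h
        · exact ⟨1, one_pos, fun δ _ _ => by rw [hv' l h, h]; simp⟩
        · refine ⟨(1 - inner ℝ n (w l)) / (|inner ℝ v (w l)| + 1),
            div_pos (by linarith) (by positivity), fun δ hδ hle => ?_⟩
          rw [le_div_iff₀ (by positivity)] at hle
          nlinarith [abs_nonneg (inner ℝ v (w l))]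
      choose e he he' using h1
      cases nonempty_fintype ι
      by_cases hne : Nonempty ι
      · obtain ⟨l0, hl0⟩ := Finite.exists_min e
        exact ⟨e l0, he l0, fun l => he' l _ (he l0) (hl0 l)⟩
      · exact ⟨1, one_pos, fun l => absurd ⟨l⟩ hne⟩
    have hmem : ∀ s : ℝ, |s| ≤ ε → n + s • v ∈ polarSet w := by
      intro s hs l
      rw [inner_add_left, real_inner_smul_left]
      have h1 : s * inner ℝ v (w l) ≤ ε * |inner ℝ v (w l)| := by
        refine (le_abs_self _).trans ?_
        rw [abs_mul]
        exact mul_le_mul_of_nonneg_right hs (abs_nonneg _)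
      linarith [hεl l]
    have hseg : n ∈ openSegment ℝ (n + ε • v) (n + (-ε) • v) := by
      refine ⟨1 / 2, 1 / 2, by norm_num, by norm_num, by norm_num, ?_⟩
      module
    have := hn.2 (hmem ε (abs_of_pos hε).le) (hmem (-ε) (by rw [abs_neg, abs_of_pos hε])) hseg
    rw [add_eq_left, smul_eq_zero] at this
    exact this.elim hε.ne' hv0
  obtain ⟨κ, a, ha, hsp, hli⟩ := exists_linearIndependent' ℝ
    (fun l : {l | inner ℝ n (w l) = 1} => w l)
  have hsp' : ⊤ ≤ Submodule.span ℝ (Set.range ((fun l : {l | inner ℝ n (w l) = 1} => w l) ∘ a)) := by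
    rw [hsp, ← hspan, Set.image_eq_range]
  let b := Module.Basis.mk hli hsp'
  have : Finite κ := Module.Finite.finite_basis b
  have hcard : Nat.card κ = 3 := by
    rw [← Module.finrank_eq_nat_card_basis b]; simp
  let e : Fin 3 ≃ κ := (Finite.equivFinOfCardEq hcard).symm
  exact ⟨fun i => (a (e i)).1, hli.comp e e.injective, fun i => (a (e i)).2⟩

/-- A point outside a polytope is separated from it by a facet, and this facet can be chosen to
be the one that is most violated. -/
theorem exists_separating_facet {ι : Type*} [Finite ι] (w : ι → E3)
    (hb : ∀ n ∈ polarSet w, ‖n‖ ≤ 2) {x : E3} (hx : x ∉ convexHull ℝ (Set.range w)) :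
    ∃ n ∈ polarSet w, 1 < inner ℝ n x ∧ (∀ n' ∈ polarSet w, inner ℝ n' x ≤ inner ℝ n x) ∧
      ∃ τ : Fin 3 → ι, LinearIndependent ℝ (fun i => w (τ i)) ∧
        ∀ i, inner ℝ n (w (τ i)) = 1 := by
  obtain ⟨n0, hn0, hn0x⟩ := exists_mem_polarSet_one_lt w hb hx
  have hcomp : IsCompact (polarSet w) := by
    refine (isCompact_closedBall (0 : E3) 2).of_isClosed_subset (isClosed_polarSet w) fun n hn => ?_
    rw [mem_closedBall_zero_iff]
    exact hb n hn
  -- The maximizers of the pairing with `x` form a compact exposed face of the polar; an extreme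
  -- point of this face is extreme in the polar.
  let l : StrongDual ℝ E3 := InnerProductSpace.toDual ℝ E3 x
  have hexp : IsExposed ℝ (polarSet w) (l.toExposed (polarSet w)) :=
    ContinuousLinearMap.toExposed.isExposed
  have hl : ∀ n, l n = inner ℝ n x := fun n => by
    simp only [l, InnerProductSpace.toDual_apply_apply, real_inner_comm]
  obtain ⟨m, hm, hmax⟩ := hcomp.exists_isMaxOn ⟨n0, hn0⟩ (l.continuous.continuousOn)
  have hne : (l.toExposed (polarSet w)).Nonempty := ⟨m, hm, fun y hy => hmax hy⟩
  obtain ⟨n, hn⟩ := (hexp.isCompact hcomp).extremePoints_nonempty hne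
  have hext := hexp.isExtreme.extremePoints_subset_extremePoints hn
  have hn' : ∀ n' ∈ polarSet w, inner ℝ n' x ≤ inner ℝ n x := fun n' hn' => by
    have := hn.1.2 n' hn'
    rwa [hl, hl] at this
  exact ⟨n, hext.1, hn0x.trans_le (hn' n0 hn0), hn', exists_linearIndependent_tight w hext⟩

theorem inner_le_one_of_mem_convexHull {ι : Type*} {w : ι → E3} {n x : E3} (hn : n ∈ polarSet w)
    (hx : x ∈ convexHull ℝ (Set.range w)) : inner ℝ n x ≤ 1 := by
  have hconv : Convex ℝ {y : E3 | inner ℝ n y ≤ 1} := by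
    intro y hy z hz a b ha hb hab
    simp only [Set.mem_ofPred_eq] at *
    rw [inner_add_right, real_inner_smul_right, real_inner_smul_right]
    nlinarith
  exact convexHull_min (by rintro _ ⟨l, rfl⟩; exact hn l) hconv hx

/-! ### Polytopes whose corners are evenly distributed on the unit sphere -/

/-- The points `v j` cover the unit sphere at scale `√ε`, and the points `w j` are
`ε`-close to them. -/
structure IsSphereNet {ι : Type*} (v w : ι → E3) (ε : ℝ) : Prop where
  pos : 0 < ε
  small : ε ≤ 1 / 100
  norm_eq : ∀ j, ‖v j‖ = 1
  cover : ∀ k : E3, ‖k‖ = 1 → ∃ j, ‖k - v j‖ ≤ √ε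
  close : ∀ j, ‖w j - v j‖ ≤ ε

namespace IsSphereNet

variable {ι : Type*} {v w : ι → E3} {ε : ℝ} (h : IsSphereNet v w ε)
include h

theorem norm_corner_le (j : ι) : ‖w j‖ ≤ 1 + ε := by
  have h1 := norm_add_le (v j) (w j - v j)
  rw [add_sub_cancel, h.norm_eq] at h1
  linarith [h.close j]

/-- A net point within `√ε` of the direction `e` of `n` has inner product at least `1 - ε / 2` with
`e`, and passing to its corner loses at most `ε`. Hence `‖n‖ (1 - 3 ε / 2) ≤ 1`. -/
theorem norm_polar_le {n : E3} (hn : n ∈ polarSet w) : ‖n‖ ≤ 1 + 3 * ε := by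
  rcases eq_or_ne n 0 with rfl | hn0
  · rw [norm_zero]; linarith [h.pos]
  have hpos : 0 < ‖n‖ := norm_pos_iff.2 hn0
  obtain ⟨j, hj⟩ := h.cover (‖n‖⁻¹ • n) (by
    rw [norm_smul, norm_inv, norm_norm, inv_mul_cancel₀ hpos.ne'])
  set e := ‖n‖⁻¹ • n with he
  have hen : ‖e‖ = 1 := by
    rw [he, norm_smul, norm_inv, norm_norm, inv_mul_cancel₀ hpos.ne']
  have hne : n = ‖n‖ • e := by rw [he, smul_smul, mul_inv_cancel₀ hpos.ne', one_smul]
  have h1 : ‖e - v j‖ ^ 2 ≤ ε := by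
    have := pow_le_pow_left₀ (norm_nonneg _) hj 2
    rwa [Real.sq_sqrt h.pos.le] at this
  have h2 := norm_sub_sq_real e (v j)
  rw [hen, h.norm_eq] at h2
  have h3 : -ε ≤ inner ℝ e (w j - v j) := by
    have := abs_real_inner_le_norm e (w j - v j)
    rw [hen, one_mul] at this
    linarith [neg_abs_le (inner ℝ e (w j - v j)), h.close j]
  rw [inner_sub_right] at h3
  have h4 := hn j
  rw [hne, real_inner_smul_left] at h4
  have h5 : 1 - 3 / 2 * ε ≤ inner ℝ e (w j) := by linarith
  have h6 : ‖n‖ * (1 - 3 / 2 * ε) ≤ 1 := (mul_le_mul_of_nonneg_left h5 hpos.le).trans h4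
  nlinarith [h.pos, h.small, mul_pos h.pos h.pos]

theorem norm_polar_le_two {n : E3} (hn : n ∈ polarSet w) : ‖n‖ ≤ 2 := by
  linarith [h.norm_polar_le hn, h.small]

/-- The facet that is most violated by `x` has its corners near the direction of `x`. -/
theorem norm_sub_le_of_tight {n e : E3} (hn : n ∈ polarSet w) (he : ‖e‖ = 1)
    (hmax : ∀ n' ∈ polarSet w, inner ℝ n' e ≤ inner ℝ n e) {i : ι} (hi : inner ℝ n (w i) = 1) :
    ‖v i - e‖ ≤ 8 * √ε := by
  have hε := h.pos
  have hε' := h.small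
  -- This competitor forces `⟨n, e⟩ ≥ 1 - ε`. As `n`, `e` and `w i` have norm at most `1 + O(ε)` and
  -- `⟨n, w i⟩ = 1`, both `‖n - e‖²` and `‖n - w i‖²` are `O(ε)`.
  have h1 : (1 + ε)⁻¹ • e ∈ polarSet w := fun l => by
    rw [real_inner_smul_left, inv_mul_le_iff₀ (by linarith), mul_one]
    have := real_inner_le_norm e (w l)
    rw [he, one_mul] at this
    exact this.trans (h.norm_corner_le l)
  have h2 := hmax _ h1
  rw [real_inner_smul_left, real_inner_self_eq_norm_sq, he, one_pow, mul_one] at h2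
  have h3 : 1 - ε ≤ (1 + ε)⁻¹ := by
    rw [← one_div, le_div_iff₀ (by linarith)]; nlinarith
  have hnn := h.norm_polar_le hn
  have hnsq : ‖n‖ ^ 2 ≤ 1 + 6 * ε + 9 * (ε * ε) :=
    (pow_le_pow_left₀ (norm_nonneg _) hnn 2).trans_eq (by ring)
  have hwsq : ‖w i‖ ^ 2 ≤ 1 + 2 * ε + ε * ε :=
    (pow_le_pow_left₀ (norm_nonneg _) (h.norm_corner_le i) 2).trans_eq (by ring)
  have hεε : ε * ε ≤ ε / 100 := by nlinarith
  have h4 := norm_sub_sq_real n e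
  have h5 := norm_sub_sq_real n (w i)
  rw [he] at h4
  rw [hi] at h5
  have hs : √ε ^ 2 = ε := Real.sq_sqrt hε.le
  have hs0 := Real.sqrt_nonneg ε
  have hs1 : √ε ≤ 1 / 10 := by
    rw [Real.sqrt_le_left (by norm_num)]; linarith
  have h6 : ‖n - e‖ ≤ 33 / 10 * √ε := by
    refine (sq_le_sq₀ (norm_nonneg _) (by positivity)).1 ?_
    rw [h4, mul_pow, hs]
    linarith
  have h7 : ‖n - w i‖ ≤ 33 / 10 * √ε := by
    refine (sq_le_sq₀ (norm_nonneg _) (by positivity)).1 ?_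
    rw [h5, mul_pow, hs]
    linarith
  have h8 : v i - e = (n - e) - (n - w i) - (w i - v i) := by abel
  rw [h8]
  have h9 := norm_sub_le ((n - e) - (n - w i)) (w i - v i)
  have h10 := norm_sub_le (n - e) (n - w i)
  have h11 : ε ≤ 1 / 10 * √ε := by nlinarith
  linarith [h.close i]

theorem mem_convexHull_of_norm_le [Finite ι] {x : E3} (hx : ‖x‖ ≤ 1 / 2) :
    x ∈ convexHull ℝ (Set.range w) := by
  by_contra hx'
  obtain ⟨n, hn, hnx⟩ := exists_mem_polarSet_one_lt w (fun n hn => h.norm_polar_le_two hn) hx'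
  have h1 := real_inner_le_norm n x
  have h2 := h.norm_polar_le_two hn
  nlinarith [norm_nonneg n, norm_nonneg x]

theorem norm_le_two_of_mem_convexHull {x : E3} (hx : x ∈ convexHull ℝ (Set.range w)) :
    ‖x‖ ≤ 2 := by
  have : convexHull ℝ (Set.range w) ⊆ Metric.closedBall 0 2 := by
    refine convexHull_min ?_ (convex_closedBall 0 2)
    rintro _ ⟨l, rfl⟩
    rw [mem_closedBall_zero_iff]
    linarith [h.norm_corner_le l, h.small]
  exact mem_closedBall_zero_iff.1 (this hx)

end IsSphereNet

/-! ### Packing -/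

/-- Two points in the same cubic cell of side `δ / 2` are at distance at most `√3 δ / 2 < δ`, so
each cell holds at most one point. -/
theorem card_le_of_separated {ι : Type*} (v : ι → E3) {δ ρ : ℝ} (hδ : 0 < δ)
    (hsep : ∀ i j, i ≠ j → δ ≤ ‖v i - v j‖) (J : Finset ι)
    (hJ : ∀ i ∈ J, ∀ j ∈ J, ‖v i - v j‖ ≤ ρ) :
    J.card ≤ (2 * ⌈2 * ρ / δ⌉₊ + 1) ^ 3 := by
  rcases J.eq_empty_or_nonempty with rfl | ⟨i0, hi0⟩
  · simp
  rw [← card_freqBox]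
  refine Finset.card_le_card_of_injOn (fun i μ => ⌊(v i μ - v i0 μ) / (δ / 2)⌋) ?_ ?_
  · intro i hi
    rw [Finset.mem_coe, mem_freqBox]
    intro μ
    have h1 : |v i μ - v i0 μ| ≤ ρ := (PiLp.norm_apply_le (v i - v i0) μ).trans (hJ i hi i0 hi0)
    have h2 : |(v i μ - v i0 μ) / (δ / 2)| ≤ ⌈2 * ρ / δ⌉₊ := by
      refine le_trans ?_ (Nat.le_ceil _)
      rw [abs_div, abs_of_pos (half_pos hδ), div_le_iff₀ (half_pos hδ)]
      calc _ ≤ ρ := h1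
        _ = _ := by field_simp
    rw [abs_le] at h2 ⊢
    exact ⟨Int.le_floor.2 (by push_cast; exact h2.1),
      Int.cast_le (R := ℝ).1 (by push_cast; exact (Int.floor_le _).trans h2.2)⟩
  · intro i _ j _ hij
    by_contra hne
    have h1 : ∀ μ, |v i μ - v j μ| ≤ δ / 2 := by
      intro μ
      have h2 := Int.abs_sub_lt_one_of_floor_eq_floor (congrFun hij μ)
      rw [← sub_div, abs_div, abs_of_pos (half_pos hδ), div_lt_one (half_pos hδ),
        sub_sub_sub_cancel_right] at h2
      exact h2.le
    have h3 : ‖v i - v j‖ ^ 2 ≤ 3 * (δ / 2) ^ 2 := by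
      rw [EuclideanSpace.real_norm_sq_eq, Fin.sum_univ_three]
      have h4 : ∀ μ, (v i - v j) μ ^ 2 ≤ (δ / 2) ^ 2 := fun μ => by
        rw [← sq_abs]
        exact pow_le_pow_left₀ (abs_nonneg _) (h1 μ) 2
      linarith [h4 0, h4 1, h4 2]
    have h5 := pow_le_pow_left₀ hδ.le (hsep i j hne) 2
    nlinarith

/-! ### Integer normals of facets -/

theorem abs_adjugate_mulVec_one_le (p : Matrix (Fin 3) (Fin 3) ℤ) {X : ℝ}
    (hX : ∀ i μ, |(p i μ : ℝ)| ≤ X) (μ : Fin 3) :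
    |((p.adjugate.mulVec (fun _ => 1) μ : ℤ) : ℝ)| ≤ 6 * X ^ 2 := by
  have hmul : ∀ i j k l, |(p i j : ℝ) * p k l| ≤ X ^ 2 := fun i j k l => by
    rw [abs_mul, sq]
    exact mul_le_mul (hX _ _) (hX _ _) (abs_nonneg _) ((abs_nonneg _).trans (hX 0 0))
  have h2 : ∀ i j k l, -X ^ 2 ≤ (p i j : ℝ) * p k l ∧ (p i j : ℝ) * p k l ≤ X ^ 2 :=
    fun i j k l => abs_le.1 (hmul i j k l)
  rw [Matrix.adjugate_fin_three, abs_le]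
  fin_cases μ <;> simp [Matrix.mulVec, dotProduct, Fin.sum_univ_three]
  · constructor <;> linarith [h2 1 1 2 2, h2 1 2 2 1, h2 0 1 2 2, h2 0 2 2 1, h2 0 1 1 2, h2 0 2 1 1]
  · constructor <;> linarith [h2 1 0 2 2, h2 1 2 2 0, h2 0 0 2 2, h2 0 2 2 0, h2 0 0 1 2, h2 0 2 1 0]
  · constructor <;> linarith [h2 1 0 2 1, h2 1 1 2 0, h2 0 0 2 1, h2 0 1 2 0, h2 0 0 1 1, h2 0 1 1 0]

/-- If the coordinates of three linearly independent points become integers after rescaling each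
coordinate, then the plane through these points has an integer normal of controlled size. -/
theorem exists_int_normal (w : Fin 3 → E3) (hli : LinearIndependent ℝ w) {r : ℝ} (hr : 0 < r)
    (a : Fin 3 → ℕ) (ha : ∀ μ, 0 < a μ) (p : Fin 3 → Fin 3 → ℤ)
    (hp : ∀ i μ, w i μ * (r * a μ) = p i μ) {X A : ℝ} (hX : ∀ i μ, |(p i μ : ℝ)| ≤ X)
    (hA : ∀ μ, (a μ : ℝ) ≤ A) :
    ∃ (l : Fin 3 → ℤ) (c : ℝ), 0 < c ∧ (∀ μ, |(l μ : ℝ)| ≤ 6 * A * X ^ 2) ∧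
      ∀ n : E3, (∀ i, inner ℝ n (w i) = 1) → ∀ μ, (l μ : ℝ) = c * n μ := by
  let W : Matrix (Fin 3) (Fin 3) ℝ := fun i μ => w i μ
  let P : Matrix (Fin 3) (Fin 3) ℤ := p
  have ha' : ∀ μ, (0 : ℝ) < a μ := fun μ => by exact_mod_cast ha μ
  have hW : W.det ≠ 0 := by
    have h1 : LinearIndependent ℝ W.row :=
      hli.map' (WithLp.linearEquiv 2 ℝ (Fin 3 → ℝ)).toLinearMap (LinearEquiv.ker _)
    rw [Matrix.linearIndependent_rows_iff_isUnit, Matrix.isUnit_iff_isUnit_det] at h1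
    exact h1.ne_zero
  have hPW : P.map (Int.cast : ℤ → ℝ) = W * Matrix.diagonal (fun μ => r * (a μ : ℝ)) := by
    ext i μ
    rw [Matrix.mul_diagonal]
    exact (hp i μ).symm
  have hdet : ((P.det : ℤ) : ℝ) ≠ 0 := by
    have h1 : ((P.det : ℤ) : ℝ) = (P.map (Int.cast : ℤ → ℝ)).det :=
      (Int.castRingHom ℝ).map_det P
    rw [h1, hPW, Matrix.det_mul, Matrix.det_diagonal]
    exact mul_ne_zero hW (Finset.prod_ne_zero_iff.2 fun μ _ => (mul_pos hr (ha' μ)).ne')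
  -- By Cramer's rule `n μ / (r * a μ)` is the adjugate applied to `1`, divided by `det P`. The
  -- factor `a μ` removes the coordinate-dependent scaling, and the sign makes `c` positive, so that
  -- inequalities keep their direction.
  refine ⟨fun μ => SignType.sign P.det * (a μ * P.adjugate.mulVec (fun _ => 1) μ),
    |((P.det : ℤ) : ℝ)| / r, by positivity, fun μ => ?_, fun n hn μ => ?_⟩
  · have h1 := abs_adjugate_mulVec_one_le P hX μ
    have h2 : |(((SignType.sign P.det : SignType) : ℤ) : ℝ)| ≤ 1 := by
      rcases SignType.sign P.det with _ | _ | _ <;> simp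
    rw [Int.cast_mul, Int.cast_mul, Int.cast_natCast, abs_mul, abs_mul, Nat.abs_cast]
    calc _ ≤ 1 * (A * (6 * X ^ 2)) := by
          gcongr
          · exact (Nat.cast_nonneg _).trans (hA 0)
          · exact hA μ
      _ = _ := by ring
  · have h1 : (P.map (Int.cast : ℤ → ℝ)).mulVec (fun μ => n μ / (r * a μ)) = fun _ => 1 := by
      ext i
      rw [← hn i, PiLp.inner_apply, Matrix.mulVec, dotProduct]
      refine Finset.sum_congr rfl fun μ _ => ?_
      have := (ha' μ).ne'
      rw [show P.map (Int.cast : ℤ → ℝ) i μ = w i μ * (r * a μ) from (hp i μ).symm]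
      simp only [RCLike.inner_apply, conj_trivial]
      field_simp
    have h2 : ((P.adjugate.mulVec (fun _ => 1) μ : ℤ) : ℝ) = P.det * (n μ / (r * a μ)) := by
      have h3 : (P.adjugate.map (Int.cast : ℤ → ℝ)) = (P.map (Int.cast : ℤ → ℝ)).adjugate :=
        (Int.castRingHom ℝ).map_adjugate P
      have h4 : ((P.adjugate.mulVec (fun _ => 1) μ : ℤ) : ℝ) =
          (P.adjugate.map (Int.cast : ℤ → ℝ)).mulVec (fun _ => 1) μ := by
        simp [Matrix.mulVec, dotProduct]
      have h5 : ((P.det : ℤ) : ℝ) = (P.map (Int.cast : ℤ → ℝ)).det :=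
        (Int.castRingHom ℝ).map_det P
      rw [h4, h3, ← h1, Matrix.mulVec_mulVec, Matrix.adjugate_mul, Matrix.smul_mulVec,
        Matrix.one_mulVec, h5]
      rfl
    have h6 : (((SignType.sign P.det : SignType) : ℤ) : ℝ) * P.det = |((P.det : ℤ) : ℝ)| := by
      have := sign_mul_self P.det
      exact_mod_cast this
    have := (ha' μ).ne'
    calc _ = (((SignType.sign P.det : SignType) : ℤ) : ℝ) *
          ((a μ : ℝ) * ((P.adjugate.mulVec (fun _ => 1) μ : ℤ) : ℝ)) := by
          rw [Int.cast_mul, Int.cast_mul, Int.cast_natCast]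
      _ = ((((SignType.sign P.det : SignType) : ℤ) : ℝ) * P.det) *
          (a μ * (n μ / (r * a μ))) := by rw [h2]; ring
      _ = |((P.det : ℤ) : ℝ)| / r * n μ := by
        rw [h6]
        generalize |((P.det : ℤ) : ℝ)| = D
        field_simp

/-! ### A partition of the lattice into thin rational cones -/

/-- The first coordinate of maximal absolute value. -/
def axis (q : Fin 3 → ℤ) : Fin 3 :=
  if |q 1| ≤ |q 0| ∧ |q 2| ≤ |q 0| then 0 else if |q 2| ≤ |q 1| then 1 else 2

/-- Ties go to the smaller index; the strict comparison with smaller indices becomes an added `1`,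
so the pieces are disjoint yet cut out by closed integer half-spaces. -/
theorem axis_eq_iff (q : Fin 3 → ℤ) (c : Fin 3) :
    axis q = c ↔ |q (c + 1)| + (if c = 2 then 1 else 0) ≤ |q c| ∧
      |q (c + 2)| + (if c = 0 then 0 else 1) ≤ |q c| := by
  unfold axis
  fin_cases c <;> simp <;> split_ifs <;> simp <;> omega

/-- The cone that contains `q`, in a partition into cones of aperture of order `1 / m`. -/
def coneKey (m : ℕ) (q : Fin 3 → ℤ) : Fin 3 × ℤ × ℤ × ℤ :=
  (axis q, (q (axis q)).sign, m * q (axis q + 1) / |q (axis q)|, m * q (axis q + 2) / |q (axis q)|)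

/-- The possible values of `coneKey`. -/
def coneKeys (m : ℕ) : Finset (Fin 3 × ℤ × ℤ × ℤ) :=
  Finset.univ ×ˢ {1, -1} ×ˢ Finset.Icc (-(m : ℤ)) m ×ˢ Finset.Icc (-(m : ℤ)) m

theorem card_coneKeys (m : ℕ) : (coneKeys m).card = 6 * (2 * m + 1) ^ 2 := by
  simp only [coneKeys, Finset.card_product, Int.card_Icc, Finset.card_univ, Fintype.card_fin]
  rw [show ((m : ℤ) + 1 - -(m : ℤ)).toNat = 2 * m + 1 by omega]
  simp
  ring

theorem axis_pos {q : Fin 3 → ℤ} (hq : q ≠ 0) : 0 < |q (axis q)| := by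
  by_contra h
  have h0 : |q (axis q)| = 0 := le_antisymm (not_lt.1 h) (abs_nonneg _)
  obtain ⟨h1, h2⟩ := (axis_eq_iff q (axis q)).1 rfl
  apply hq
  have h3 : q (axis q + 1) = 0 := by
    have := abs_nonneg (q (axis q + 1))
    rw [← abs_eq_zero]; split_ifs at h1 <;> omega
  have h4 : q (axis q + 2) = 0 := by
    have := abs_nonneg (q (axis q + 2))
    rw [← abs_eq_zero]; split_ifs at h2 <;> omega
  rw [abs_eq_zero] at h0
  revert h0 h3 h4
  generalize axis q = c
  intro h0 h3 h4
  ext i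
  fin_cases c <;> fin_cases i <;> first | exact h0 | exact h3 | exact h4

theorem abs_le_axis (q : Fin 3 → ℤ) :
    |q (axis q + 1)| ≤ |q (axis q)| ∧ |q (axis q + 2)| ≤ |q (axis q)| := by
  obtain ⟨h1, h2⟩ := (axis_eq_iff q (axis q)).1 rfl
  constructor
  · split_ifs at h1 <;> omega
  · split_ifs at h2 <;> omega

theorem coneKey_mem (m : ℕ) {q : Fin 3 → ℤ} (hq : q ≠ 0) : coneKey m q ∈ coneKeys m := by
  have hpos := axis_pos hq
  have hle := abs_le_axis q
  have hm : (0 : ℤ) ≤ m := Int.natCast_nonneg m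
  have hdiv : ∀ y : ℤ, |y| ≤ |q (axis q)| → m * y / |q (axis q)| ∈ Finset.Icc (-(m : ℤ)) m := by
    intro y hy
    rw [abs_le] at hy
    rw [Finset.mem_Icc]
    constructor
    · rw [Int.le_ediv_iff_mul_le hpos]; nlinarith
    · apply Int.le_of_lt_add_one
      rw [Int.ediv_lt_iff_lt_mul hpos]; nlinarith
  simp only [coneKeys, coneKey, Finset.mem_product, Finset.mem_univ, true_and, Finset.mem_insert,
    Finset.mem_singleton]
  refine ⟨?_, hdiv _ hle.1, hdiv _ hle.2⟩
  rcases lt_or_gt_of_ne (abs_pos.1 hpos) with h | h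
  · exact Or.inr (Int.sign_eq_neg_one_of_neg h)
  · exact Or.inl (Int.sign_eq_one_of_pos h)

/-- The integer linear form with the given coefficients, numbered cyclically from `c`. -/
def cyclicForm (c : Fin 3) (x y z : ℤ) : Fin 3 → ℤ :=
  Pi.single c x + Pi.single (c + 1) y + Pi.single (c + 2) z

theorem cyclicForm_dotProduct (c : Fin 3) (x y z : ℤ) (q : Fin 3 → ℤ) :
    cyclicForm c x y z ⬝ᵥ q = x * q c + y * q (c + 1) + z * q (c + 2) := by
  simp [cyclicForm, add_dotProduct, single_dotProduct]

theorem abs_cyclicForm_le {c : Fin 3} {x y z : ℤ} {A : ℤ} (hx : |x| ≤ A) (hy : |y| ≤ A)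
    (hz : |z| ≤ A) (i : Fin 3) : |cyclicForm c x y z i| ≤ A := by
  fin_cases c <;> fin_cases i <;> simpa [cyclicForm, Pi.single_apply]

/-- The half-spaces that bound the cone with key `(c, e, α, β)`. -/
def coneHalfSpaces (m : ℕ) (k : Fin 3 × ℤ × ℤ × ℤ) : Finset ((Fin 3 → ℤ) × ℤ) :=
  {(cyclicForm k.1 (-k.2.1) 0 0, -1),
   (cyclicForm k.1 (-k.2.1) 1 0, -(if k.1 = 2 then 1 else 0)),
   (cyclicForm k.1 (-k.2.1) (-1) 0, -(if k.1 = 2 then 1 else 0)),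
   (cyclicForm k.1 (-k.2.1) 0 1, -(if k.1 = 0 then 0 else 1)),
   (cyclicForm k.1 (-k.2.1) 0 (-1), -(if k.1 = 0 then 0 else 1)),
   (cyclicForm k.1 (k.2.2.1 * k.2.1) (-m) 0, 0),
   (cyclicForm k.1 (-((k.2.2.1 + 1) * k.2.1)) m 0, -1),
   (cyclicForm k.1 (k.2.2.2 * k.2.1) 0 (-m), 0),
   (cyclicForm k.1 (-((k.2.2.2 + 1) * k.2.1)) 0 m, -1)}

theorem card_coneHalfSpaces_le (m : ℕ) (k : Fin 3 × ℤ × ℤ × ℤ) :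
    (coneHalfSpaces m k).card ≤ 9 := by
  unfold coneHalfSpaces
  repeat' refine (Finset.card_insert_le _ _).trans (Nat.succ_le_succ ?_)
  simp

theorem abs_coneHalfSpaces_le {m : ℕ} {k : Fin 3 × ℤ × ℤ × ℤ} (hk : k ∈ coneKeys m)
    {h : (Fin 3 → ℤ) × ℤ} (hh : h ∈ coneHalfSpaces m k) (i : Fin 3) : |h.1 i| ≤ m + 1 := by
  obtain ⟨c, e, α, β⟩ := k
  simp only [coneKeys, Finset.mem_product, Finset.mem_univ, true_and, Finset.mem_insert,
    Finset.mem_singleton, Finset.mem_Icc] at hk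
  obtain ⟨he, ⟨hα, hα'⟩, hβ, hβ'⟩ := hk
  simp only [coneHalfSpaces, Finset.mem_insert, Finset.mem_singleton] at hh
  rcases hh with rfl | rfl | rfl | rfl | rfl | rfl | rfl | rfl | rfl <;>
    refine abs_cyclicForm_le ?_ ?_ ?_ i <;> rcases he with rfl | rfl <;>
    rw [abs_le] <;> constructor <;> omega

/-- Once the sign `e` is fixed, `|q c| = e * q c` is linear, and each integer quotient becomes two
linear inequalities. Integrality turns strict ones into thresholds `-1`; the first half-space also
excludes the origin. -/
theorem mem_coneHalfSpaces_iff {m : ℕ} {k : Fin 3 × ℤ × ℤ × ℤ} (hk : k ∈ coneKeys m)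
    (q : Fin 3 → ℤ) : MemHalfSpaces (coneHalfSpaces m k) q ↔ q ≠ 0 ∧ coneKey m q = k := by
  obtain ⟨c, e, α, β⟩ := k
  simp only [coneKeys, Finset.mem_product, Finset.mem_univ, true_and, Finset.mem_insert,
    Finset.mem_singleton, Finset.mem_Icc] at hk
  obtain ⟨he, -, -⟩ := hk
  have key : (q ≠ 0 ∧ coneKey m q = (c, e, α, β)) ↔ (1 ≤ e * q c ∧ axis q = c ∧
      m * q (c + 1) / (e * q c) = α ∧ m * q (c + 2) / (e * q c) = β) := by
    constructor
    · rintro ⟨hq, hkey⟩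
      simp only [coneKey, Prod.mk.injEq] at hkey
      obtain ⟨h1, h2, h3, h4⟩ := hkey
      have hpos := axis_pos hq
      rw [h1] at h2 h3 h4 hpos
      have habs : |q c| = e * q c := by rw [← h2, Int.sign_mul_self_eq_abs]
      rw [habs] at h3 h4 hpos
      exact ⟨by omega, h1, h3, h4⟩
    · rintro ⟨h0, h1, h3, h4⟩
      have habs : |q c| = e * q c := by
        rcases he with rfl | rfl
        · rw [abs_of_pos (by omega), one_mul]
        · rw [abs_of_neg (by omega)]; ring
      have hsign : (q c).sign = e := by
        rcases he with rfl | rfl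
        · exact Int.sign_eq_one_of_pos (by omega)
        · exact Int.sign_eq_neg_one_of_neg (by omega)
      refine ⟨fun h => ?_, ?_⟩
      · rw [h] at h0; simp at h0
      · simp only [coneKey, h1, habs, hsign, h3, h4]
  rw [key, axis_eq_iff]
  simp only [MemHalfSpaces, coneHalfSpaces, Finset.forall_mem_insert, Finset.mem_singleton,
    forall_eq, cyclicForm_dotProduct]
  have hab : 1 ≤ e * q c → |q c| = e * q c := by
    intro h0
    rcases he with rfl | rfl
    · rw [abs_of_pos (by omega), one_mul]
    · rw [abs_of_neg (by omega)]; ring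
  have hdiv : ∀ y γ : ℤ, 1 ≤ e * q c → (m * y / (e * q c) = γ ↔
      γ * (e * q c) ≤ m * y ∧ m * y < (γ + 1) * (e * q c)) := by
    intro y γ h0
    have hpos : 0 < e * q c := by omega
    rw [← Int.le_ediv_iff_mul_le hpos, ← Int.ediv_lt_iff_lt_mul hpos]
    omega
  generalize (if c = 2 then (1 : ℤ) else 0) = s1
  generalize (if c = 0 then (0 : ℤ) else 1) = s2
  constructor
  · rintro ⟨h1, h2, h3, h4, h5, h6, h7, h8, h9⟩
    have h0 : 1 ≤ e * q c := by linarith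
    rw [hab h0, hdiv _ _ h0, hdiv _ _ h0]
    refine ⟨h0, ⟨?_, ?_⟩, ⟨by linarith, by linarith⟩, ⟨by linarith, by linarith⟩⟩
    · have : |q (c + 1)| ≤ e * q c - s1 := abs_le.2 ⟨by linarith, by linarith⟩
      linarith
    · have : |q (c + 2)| ≤ e * q c - s2 := abs_le.2 ⟨by linarith, by linarith⟩
      linarith
  · rintro ⟨h0, ⟨h1, h2⟩, h3, h4⟩
    rw [hab h0] at h1 h2
    rw [hdiv _ _ h0] at h3 h4
    have h5 := abs_le.1 (by linarith : |q (c + 1)| ≤ e * q c - s1)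
    have h6 := abs_le.1 (by linarith : |q (c + 2)| ≤ e * q c - s2)
    refine ⟨?_, ?_, ?_, ?_, ?_, ?_, ?_, ?_, ?_⟩ <;> linarith

/-! ### The polytope inside a thin cone -/

/-- A lattice point as an element of Euclidean space. -/
def latticeVec (q : Fin 3 → ℤ) : E3 := WithLp.toLp 2 (fun i => (q i : ℝ))

/-- The direction of a lattice point. -/
def latticeDir (q : Fin 3 → ℤ) : E3 := ‖latticeVec q‖⁻¹ • latticeVec q

theorem latticeVec_ne_zero {q : Fin 3 → ℤ} (hq : q ≠ 0) : latticeVec q ≠ 0 := by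
  obtain ⟨i, hi⟩ := Function.ne_iff.1 hq
  intro h
  apply hi
  have h1 : latticeVec q i = 0 := by rw [h]; rfl
  exact Int.cast_eq_zero.1 (show (q i : ℝ) = 0 from h1)

theorem norm_latticeDir {q : Fin 3 → ℤ} (hq : q ≠ 0) : ‖latticeDir q‖ = 1 := by
  rw [latticeDir, norm_smul, norm_inv, norm_norm,
    inv_mul_cancel₀ (norm_ne_zero_iff.2 (latticeVec_ne_zero hq))]

theorem norm_normalize_sub_le {x y : E3} (hx : 1 ≤ ‖x‖) (hy : y ≠ 0) :
    ‖‖x‖⁻¹ • x - ‖y‖⁻¹ • y‖ ≤ 2 * ‖x - y‖ := by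
  have hx0 : 0 < ‖x‖ := by linarith
  have hy0 : 0 < ‖y‖ := norm_pos_iff.2 hy
  have h1 : ‖x‖⁻¹ • x - ‖y‖⁻¹ • y = ‖x‖⁻¹ • ((x - y) + ((‖y‖ - ‖x‖) * ‖y‖⁻¹) • y) := by
    rw [sub_mul, mul_inv_cancel₀ hy0.ne', sub_smul, one_smul, smul_add, smul_sub, smul_sub,
      smul_smul, ← mul_assoc, inv_mul_cancel₀ hx0.ne', one_mul]
    abel
  have h2 : ‖((‖y‖ - ‖x‖) * ‖y‖⁻¹) • y‖ ≤ ‖x - y‖ := by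
    rw [norm_smul, norm_mul, norm_inv, norm_norm, mul_assoc, inv_mul_cancel₀ hy0.ne', mul_one,
      norm_sub_rev x y]
    exact abs_norm_sub_norm_le y x
  rw [h1, norm_smul, norm_inv, norm_norm]
  have h3 := norm_add_le (x - y) (((‖y‖ - ‖x‖) * ‖y‖⁻¹) • y)
  calc _ ≤ 1 * (2 * ‖x - y‖) := by
        gcongr
        · exact inv_le_one_of_one_le₀ hx
        · linarith
    _ = _ := one_mul _

/-- Divided by the modulus of the dominant coordinate, both points lie on the same face of the unit
cube, with the other coordinates in common intervals of length `1 / m`. Radial projection at most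
doubles the distance. -/
theorem norm_latticeDir_sub_le {m : ℕ} (hm : 0 < m) {q q' : Fin 3 → ℤ} (hq : q ≠ 0) (hq' : q' ≠ 0)
    (h : coneKey m q = coneKey m q') : ‖latticeDir q - latticeDir q'‖ ≤ 4 / m := by
  have hm' : (0 : ℝ) < m := by exact_mod_cast hm
  have hpos := axis_pos hq
  have hpos' := axis_pos hq'
  simp only [coneKey, Prod.mk.injEq] at h
  obtain ⟨h1, h2, h3, h4⟩ := h
  rw [← h1] at h2 h3 h4 hpos'
  revert h2 h3 h4 hpos hpos'
  generalize axis q = c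
  intro hpos hpos' h2 h3 h4
  set d : ℝ := |(q c : ℝ)| with hd
  set d' : ℝ := |(q' c : ℝ)| with hd'
  have hdi : ((|q c| : ℤ) : ℝ) = d := by push_cast; rfl
  have hdi' : ((|q' c| : ℤ) : ℝ) = d' := by push_cast; rfl
  have hd0 : 0 < d := by rw [← hdi]; exact_mod_cast hpos
  have hd0' : 0 < d' := by rw [← hdi']; exact_mod_cast hpos'
  have hdir : ∀ (p : Fin 3 → ℤ) (e : ℝ), 0 < e →
      latticeDir p = ‖e⁻¹ • latticeVec p‖⁻¹ • e⁻¹ • latticeVec p := by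
    intro p e he
    rw [latticeDir, norm_smul, smul_smul, mul_inv, norm_inv, inv_inv, Real.norm_eq_abs,
      abs_of_pos he, mul_right_comm, mul_inv_cancel₀ he.ne', one_mul]
  have hx : 1 ≤ ‖d⁻¹ • latticeVec q‖ := by
    refine le_trans (le_of_eq ?_) (PiLp.norm_apply_le (d⁻¹ • latticeVec q) c)
    rw [PiLp.smul_apply, norm_smul, norm_inv, Real.norm_eq_abs, abs_of_pos hd0]
    exact (inv_mul_cancel₀ hd0.ne').symm
  have hfl : ∀ y y' : ℤ, (m : ℤ) * y / |q c| = m * y' / |q' c| →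
      (d⁻¹ * y - d'⁻¹ * y') ^ 2 ≤ (1 / m) ^ 2 := by
    intro y y' hyy
    obtain ⟨k, hk⟩ : ∃ k, (m : ℤ) * y / |q c| = k := ⟨_, rfl⟩
    have a1 : (k : ℝ) * d ≤ m * y := by
      rw [← hdi]; exact_mod_cast (Int.le_ediv_iff_mul_le hpos).1 hk.ge
    have a2 : (m : ℝ) * y < (k + 1) * d := by
      rw [← hdi]; exact_mod_cast (Int.ediv_lt_iff_lt_mul hpos).1 (by omega : _ < k + 1)
    rw [hyy] at hk
    have b1 : (k : ℝ) * d' ≤ m * y' := by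
      rw [← hdi']; exact_mod_cast (Int.le_ediv_iff_mul_le hpos').1 hk.ge
    have b2 : (m : ℝ) * y' < (k + 1) * d' := by
      rw [← hdi']; exact_mod_cast (Int.ediv_lt_iff_lt_mul hpos').1 (by omega : _ < k + 1)
    have c1 : (k : ℝ) / m ≤ d⁻¹ * y := by
      rw [inv_mul_eq_div, div_le_div_iff₀ hm' hd0]; linarith
    have c2 : d⁻¹ * y ≤ (k + 1) / m := by
      rw [inv_mul_eq_div, div_le_div_iff₀ hd0 hm']; linarith
    have c3 : (k : ℝ) / m ≤ d'⁻¹ * y' := by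
      rw [inv_mul_eq_div, div_le_div_iff₀ hm' hd0']; linarith
    have c4 : d'⁻¹ * y' ≤ (k + 1) / m := by
      rw [inv_mul_eq_div, div_le_div_iff₀ hd0' hm']; linarith
    rw [add_div] at c2 c4
    refine sq_le_sq' ?_ ?_ <;> linarith
  have hc : d⁻¹ * (q c : ℝ) - d'⁻¹ * q' c = 0 := by
    have e1 : (q c : ℝ) = (q c).sign * d := by
      rw [← hdi]; exact_mod_cast (Int.sign_mul_abs (q c)).symm
    have e2 : (q' c : ℝ) = (q' c).sign * d' := by
      rw [← hdi']; exact_mod_cast (Int.sign_mul_abs (q' c)).symm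
    rw [e1, e2, h2]
    field_simp
    ring
  have hsum : ∀ f : Fin 3 → ℝ, ∑ i, f i = f c + f (c + 1) + f (c + 2) := by
    intro f
    rw [Fin.sum_univ_three]
    fin_cases c
    · rfl
    · change f 0 + f 1 + f 2 = f 1 + f 2 + f 0; ring
    · change f 0 + f 1 + f 2 = f 2 + f 0 + f 1; ring
  have hxy : ‖d⁻¹ • latticeVec q - d'⁻¹ • latticeVec q'‖ ≤ 2 / m := by
    refine (sq_le_sq₀ (norm_nonneg _) (by positivity)).1 ?_
    rw [EuclideanSpace.real_norm_sq_eq, hsum]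
    have e0 : (d⁻¹ • latticeVec q - d'⁻¹ • latticeVec q') c = 0 := hc
    have e1 : (d⁻¹ • latticeVec q - d'⁻¹ • latticeVec q') (c + 1) ^ 2 ≤ (1 / m) ^ 2 := hfl _ _ h3
    have e2 : (d⁻¹ • latticeVec q - d'⁻¹ • latticeVec q') (c + 2) ^ 2 ≤ (1 / m) ^ 2 := hfl _ _ h4
    have e3 : (2 / (m : ℝ)) ^ 2 = 4 * (1 / m) ^ 2 := by ring
    have e4 : (0 : ℝ) ≤ (1 / m) ^ 2 := by positivity
    rw [e0, e3]
    linarith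
  rw [hdir q d hd0, hdir q' d' hd0']
  refine (norm_normalize_sub_le hx ?_).trans ?_
  · exact smul_ne_zero (inv_ne_zero hd0'.ne') (latticeVec_ne_zero hq')
  · calc _ ≤ 2 * (2 / (m : ℝ)) := by gcongr
      _ = _ := by ring

/-- Inside each thin cone, a dilated polytope with evenly distributed corners is cut out by a
bounded number of half-spaces with integer normals. -/
theorem exists_halfSpaces_of_coneKey {ι : Type*} [Fintype ι] {v w : ι → E3} {ε : ℝ}
    (h : IsSphereNet v w ε) {δ : ℝ} (hδ : 0 < δ) (hsep : ∀ i j, i ≠ j → δ ≤ ‖v i - v j‖)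
    {r : ℝ} (hr : 0 < r) (a : Fin 3 → ℕ) (ha : ∀ μ, 0 < a μ) (p : ι → Fin 3 → ℤ)
    (hp : ∀ i μ, w i μ * (r * a μ) = p i μ) {X A : ℝ} (hX : ∀ i μ, |(p i μ : ℝ)| ≤ X)
    (hA : ∀ μ, (a μ : ℝ) ≤ A) {m : ℕ} (hm : 0 < m) {y : ℝ} (hy : 0 < y)
    {k : Fin 3 × ℤ × ℤ × ℤ} (hk : k ∈ coneKeys m) :
    ∃ S : Finset ((Fin 3 → ℤ) × ℤ),
      S.card ≤ 9 + ((2 * ⌈2 * (16 * √ε + 4 / m) / δ⌉₊ + 1) ^ 3) ^ 3 ∧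
      (∀ f ∈ S, ∀ μ, |(f.1 μ : ℝ)| ≤ (m + 1) + 6 * A * X ^ 2) ∧
      ∀ q, MemHalfSpaces S q ↔ (q ≠ 0 ∧ coneKey m q = k) ∧
        y⁻¹ • latticeVec q ∈ convexHull ℝ (Set.range w) := by
  classical
  have hA0 : 0 ≤ A := (Nat.cast_nonneg _).trans (hA 0)
  -- The corners visible from the cone: only they can span the most violated facet at a point of it.
  -- Their mutual distance is at most twice `8 √ε` plus the aperture `4 / m`, so packing bounds
  -- their number.
  let J : Finset ι := Finset.univ.filter fun i =>
    ∃ q, q ≠ 0 ∧ coneKey m q = k ∧ ‖v i - latticeDir q‖ ≤ 8 * √ε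
  have hJ : J.card ≤ (2 * ⌈2 * (16 * √ε + 4 / m) / δ⌉₊ + 1) ^ 3 := by
    refine card_le_of_separated v hδ hsep J fun i hi j hj => ?_
    obtain ⟨q, hq, hqk, hqi⟩ := (Finset.mem_filter.1 hi).2
    obtain ⟨q', hq', hqk', hqj⟩ := (Finset.mem_filter.1 hj).2
    have h1 := norm_latticeDir_sub_le hm hq hq' (hqk.trans hqk'.symm)
    have h2 : v i - v j = (v i - latticeDir q) + (latticeDir q - latticeDir q') -
      (v j - latticeDir q') := by abel
    rw [h2]
    have h3 := norm_sub_le ((v i - latticeDir q) + (latticeDir q - latticeDir q'))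
      (v j - latticeDir q')
    have h4 := norm_add_le (v i - latticeDir q) (latticeDir q - latticeDir q')
    linarith
  let F : (Fin 3 → ι) → Prop := fun τ => LinearIndependent ℝ (fun i => w (τ i)) ∧
    ∃ n ∈ polarSet w, ∀ i, inner ℝ n (w (τ i)) = 1
  have hex : ∀ τ : Fin 3 → ι, ∃ f : (Fin 3 → ℤ) × ℤ, F τ →
      (∀ μ, |(f.1 μ : ℝ)| ≤ 6 * A * X ^ 2) ∧
      ∀ n : E3, (∀ i, inner ℝ n (w (τ i)) = 1) → ∀ q : Fin 3 → ℤ,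
        (f.1 ⬝ᵥ q ≤ f.2 ↔ inner ℝ n (y⁻¹ • latticeVec q) ≤ 1) := by
    intro τ
    by_cases hF : F τ
    · obtain ⟨l, c, hc, hl, hln⟩ := exists_int_normal (fun i => w (τ i)) hF.1 hr a ha
        (fun i => p (τ i)) (fun i μ => hp (τ i) μ) (fun i μ => hX (τ i) μ) hA
      -- Since `l · q` is an integer, rounding the threshold down loses nothing.
      refine ⟨(l, ⌊c * y⌋), fun _ => ⟨hl, fun n hn q => ?_⟩⟩
      have h1 : ((l ⬝ᵥ q : ℤ) : ℝ) = c * inner ℝ n (latticeVec q) := by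
        rw [dotProduct, PiLp.inner_apply, Finset.mul_sum]
        push_cast
        refine Finset.sum_congr rfl fun μ _ => ?_
        rw [hln n hn μ]
        simp only [latticeVec, RCLike.inner_apply, conj_trivial]
        ring
      rw [Int.le_floor, h1, real_inner_smul_right, inv_mul_le_iff₀ hy, mul_one,
        mul_le_mul_iff_right₀ hc]
    · exact ⟨0, fun h => absurd h hF⟩
  choose f hf using hex
  let T : Finset (Fin 3 → ι) := (Fintype.piFinset fun _ => J).filter F
  refine ⟨coneHalfSpaces m k ∪ T.image f, ?_, ?_, fun q => ?_⟩
  · refine (Finset.card_union_le _ _).trans (add_le_add (card_coneHalfSpaces_le m k) ?_)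
    refine Finset.card_image_le.trans ((Finset.card_filter_le _ _).trans ?_)
    rw [Fintype.card_piFinset_const]
    exact Nat.pow_le_pow_left hJ 3
  · intro g hg μ
    rcases Finset.mem_union.1 hg with hg | hg
    · have h1 : |(g.1 μ : ℝ)| ≤ m + 1 := by exact_mod_cast abs_coneHalfSpaces_le hk hg μ
      have h2 : 0 ≤ 6 * A * X ^ 2 := by positivity
      linarith
    · obtain ⟨τ, hτ, rfl⟩ := Finset.mem_image.1 hg
      have h1 := (hf τ (Finset.mem_filter.1 hτ).2).1 μ
      have h2 : (0 : ℝ) ≤ m + 1 := by positivity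
      linarith
  · have hsplit : MemHalfSpaces (coneHalfSpaces m k ∪ T.image f) q ↔
        MemHalfSpaces (coneHalfSpaces m k) q ∧ ∀ τ ∈ T, (f τ).1 ⬝ᵥ q ≤ (f τ).2 := by
      simp only [MemHalfSpaces, Finset.mem_union, Finset.mem_image, or_imp, forall_and,
        forall_exists_index, and_imp, forall_apply_eq_imp_iff₂]
    rw [hsplit, mem_coneHalfSpaces_iff hk]
    refine and_congr_right fun hq => ⟨fun hT => ?_, fun hx τ hτ => ?_⟩
    · by_contra hx
      obtain ⟨n, hn, hnx, hmax, τ, hli, hτ⟩ :=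
        exists_separating_facet w (fun n hn => h.norm_polar_le_two hn) hx
      have hF : F τ := ⟨hli, n, hn, hτ⟩
      have hτJ : ∀ i, τ i ∈ J := by
        intro i
        refine Finset.mem_filter.2 ⟨Finset.mem_univ _, q, hq.1, hq.2, ?_⟩
        refine h.norm_sub_le_of_tight hn (norm_latticeDir hq.1) (fun n' hn' => ?_) (hτ i)
        have h1 := hmax n' hn'
        rw [real_inner_smul_right, real_inner_smul_right,
          mul_le_mul_iff_right₀ (inv_pos.2 hy)] at h1
        rw [latticeDir, real_inner_smul_right, real_inner_smul_right]
        exact mul_le_mul_of_nonneg_left h1 (by positivity)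
      have h2 := hT τ (Finset.mem_filter.2 ⟨Fintype.mem_piFinset.2 hτJ, hF⟩)
      exact absurd (((hf τ hF).2 n hτ q).1 h2) (not_le.2 hnx)
    · have hF := (Finset.mem_filter.1 hτ).2
      obtain ⟨-, n, hn, hτn⟩ := id hF
      exact ((hf τ hF).2 n hτn q).2 (inner_le_one_of_mem_convexHull hn hx)

/-! ### Lebesgue norms of the lattice points in a polytope -/

theorem trigPoly_eq_of_subset [DecidableEq (Fin 3 → ℤ)] {Ω' Ω : Finset (Fin 3 → ℤ)} (hΩ : Ω' ⊆ Ω)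
    (c : (Fin 3 → ℤ) → ℂ) (u : Fin 3 → ℝ) :
    trigPoly Ω' c u = trigPoly Ω (fun q => if q ∈ Ω' then c q else 0) u := by
  simp only [trigPoly, ite_mul, zero_mul]
  rw [← Finset.sum_filter, Finset.filter_mem_eq_inter, Finset.inter_eq_right.2 hΩ]

theorem abs_dotProduct_le {l q : Fin 3 → ℤ} {A : ℝ} {n : ℕ} (hl : ∀ μ, |(l μ : ℝ)| ≤ A)
    (hq : q ∈ freqBox n) : ((|l ⬝ᵥ q| : ℤ) : ℝ) ≤ 3 * A * n := by
  have hA : 0 ≤ A := (abs_nonneg _).trans (hl 0)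
  rw [dotProduct, Int.cast_abs, Int.cast_sum]
  refine (Finset.abs_sum_le_sum_abs _ _).trans ?_
  calc _ ≤ ∑ _i : Fin 3, A * n := by
        refine Finset.sum_le_sum fun i _ => ?_
        rw [Int.cast_mul, abs_mul]
        exact mul_le_mul (hl i) (abs_coord_le_of_mem_freqBox hq i) (abs_nonneg _) hA
    _ = _ := by simp; ring

/-- If a set of lattice points is cut out by few half-spaces in each thin cone, its weighted
exponential sum is controlled by any kernel that reproduces the weight. -/
theorem lebesgueNorm_le_of_cones (Ω : Finset (Fin 3 → ℤ)) {B m b : ℕ} {A : ℝ}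
    (hΩ : Ω ⊆ freqBox B)
    (hS : ∀ k ∈ coneKeys m, ∃ S : Finset ((Fin 3 → ℤ) × ℤ), S.card ≤ b ∧
      (∀ f ∈ S, ∀ μ, |(f.1 μ : ℝ)| ≤ A) ∧
      ∀ q, MemHalfSpaces S q ↔ (q ≠ 0 ∧ coneKey m q = k) ∧ q ∈ Ω)
    (t : (Fin 3 → ℤ) → ℝ) (ht : t 0 = 0) (c : (Fin 3 → ℤ) → ℂ)
    (hc : ∀ q ∈ freqBox B, c q = t q) :
    lebesgueNorm Ω (fun q => (t q : ℂ)) ≤ 6 * (2 * m + 1) ^ 2 * 16 ^ b *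
      ((2 + Real.log (2 * ⌈9 * A * B⌉₊ + 1)) ^ 3 * lebesgueNorm (freqBox (3 * B)) c) := by
  classical
  choose! S hScard hSA hSmem using hS
  have hlog : 0 ≤ Real.log (2 * (⌈9 * A * B⌉₊ : ℝ) + 1) :=
    Real.log_nonneg (by linarith [(Nat.cast_nonneg ⌈9 * A * B⌉₊ : (0 : ℝ) ≤ ⌈9 * A * B⌉₊)])
  have hsub : Ω ⊆ freqBox (3 * B) := by
    intro q hq
    have := hΩ hq
    rw [mem_freqBox] at *
    exact fun i => (this i).trans (by push_cast; omega)
  have h1 : lebesgueNorm Ω (fun q => (t q : ℂ)) =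
      lebesgueNorm (freqBox (3 * B)) (fun q => if q ∈ Ω then (t q : ℂ) else 0) := by
    unfold lebesgueNorm
    simp only [trigPoly_eq_of_subset hsub]
  -- The cuts act on the kernel `c`; it may differ from `t` outside the box of size `B`, but every
  -- cut lands in `Ω` inside that box. No cone contains the origin, where `t` vanishes.
  have h2 : ∀ q ∈ freqBox (3 * B), (if q ∈ Ω then (t q : ℂ) else 0) =
      ∑ k ∈ coneKeys m, 1 * cutCoeff (S k) c q := by
    intro q _
    by_cases hq : q ∈ Ω ∧ q ≠ 0
    · have hmem := coneKey_mem m hq.2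
      rw [if_pos hq.1, Finset.sum_eq_single_of_mem _ hmem]
      · rw [cutCoeff, if_pos ((hSmem _ hmem q).2 ⟨⟨hq.2, rfl⟩, hq.1⟩), one_mul, hc q (hΩ hq.1)]
      · intro k hk hne
        rw [cutCoeff, if_neg fun h => hne ((hSmem k hk q).1 h).1.2.symm, mul_zero]
    · rw [Finset.sum_eq_zero fun k hk => by
        rw [cutCoeff, if_neg fun h => hq ⟨((hSmem k hk q).1 h).2, ((hSmem k hk q).1 h).1.1⟩,
          mul_zero]]
      split_ifs with hqΩ
      · have : q = 0 := by_contra fun h => hq ⟨hqΩ, h⟩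
        rw [this, ht, Complex.ofReal_zero]
      · rfl
  rw [h1]
  refine (lebesgueNorm_le_sum (coneKeys m) _ _ (fun k => cutCoeff (S k) c) (fun _ => 1) h2).trans ?_
  have h3 : ∀ k ∈ coneKeys m, ‖(1 : ℂ)‖ * lebesgueNorm (freqBox (3 * B)) (cutCoeff (S k) c) ≤
      16 ^ b * ((2 + Real.log (2 * ⌈9 * A * B⌉₊ + 1)) ^ 3 *
        lebesgueNorm (freqBox (3 * B)) c) := by
    intro k hk
    rw [norm_one, one_mul]
    -- Three coordinates, coefficients at most `A` and frequencies at most `3 * B` give the `9`.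
    refine (lebesgueNorm_cutCoeff_le _ c ⌈9 * A * B⌉₊ (S k) fun f hf q hq => ?_).trans ?_
    · have h4 := abs_dotProduct_le (hSA k hk f hf) hq
      have h5 := Nat.le_ceil (9 * A * (B : ℝ))
      push_cast at h4
      have h6 : ((|f.1 ⬝ᵥ q| : ℤ) : ℝ) ≤ ⌈9 * A * B⌉₊ := by push_cast; linarith
      exact_mod_cast h6
    · refine mul_le_mul_of_nonneg_right (pow_le_pow_right₀ (by norm_num) (hScard k hk)) ?_
      exact mul_nonneg (by positivity) (lebesgueNorm_nonneg _ _)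
  refine (Finset.sum_le_card_nsmul _ _ _ h3).trans (le_of_eq ?_)
  rw [card_coneKeys, nsmul_eq_mul]
  push_cast
  ring

/-! ### The Fermi polyhedron -/

namespace FermiData

variable (D : FermiData)

theorem N_eq_card_lattice (hL : 0 < D.L) : D.N = D.lattice.card := by
  have hc : (2 * Real.pi / D.L) ≠ 0 := by positivity
  have h1 : D.PF = (fun q => (2 * Real.pi / D.L) • latticeVec q) '' D.latticeSet := by
    have hkF : D.kF • D.P = (2 * Real.pi / D.L) • D.R • D.P := by
      rw [smul_smul, R]
      congr 1
      field_simp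
    ext k
    rw [PF, hkF]
    constructor
    · rintro ⟨hk, q, hq⟩
      have hkq : (2 * Real.pi / D.L) • latticeVec q = k := by
        ext i
        exact (hq i).symm
      refine ⟨q, ?_, hkq⟩
      rw [← hkq, Set.smul_mem_smul_set_iff₀ hc] at hk
      exact hk
    · rintro ⟨q, hq, rfl⟩
      exact ⟨Set.smul_mem_smul_set hq, q, fun i => rfl⟩
  have hinj : Function.Injective fun q => (2 * Real.pi / D.L) • latticeVec q := by
    intro q q' h
    have h2 : latticeVec q = latticeVec q' := smul_right_injective E3 hc h
    ext i
    have h3 : (q i : ℝ) = q' i := congrFun (congrArg WithLp.ofLp h2) i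
    exact_mod_cast h3
  rw [N, h1, Set.ncard_image_of_injective _ hinj, lattice, Set.ncard_eq_toFinset_card _
    D.latticeSet_finite]

/-- The corners of the polyhedron, rescaled to lie near the unit sphere. -/
def corner (j : Fin D.s) : E3 := (D.Q ^ (-(3 / 4) : ℝ))⁻¹ • D.κ j

/-- The initial points, rescaled to lie on the unit sphere. -/
def spherePoint (j : Fin D.s) : E3 := (D.Q ^ (-(3 / 4) : ℝ))⁻¹ • D.κR j

/-- The scale of the dilated polyhedron. -/
def scale : ℝ := D.R * D.σ * D.Q ^ (-(3 / 4) : ℝ)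

theorem mem_lattice_iff (hs : 0 < D.scale) (hQ : 0 < D.Q) (q : Fin 3 → ℤ) :
    q ∈ D.lattice ↔ D.scale⁻¹ • latticeVec q ∈ convexHull ℝ (Set.range D.corner) := by
  have hr : (D.Q ^ (-(3 / 4) : ℝ)) ≠ 0 := (Real.rpow_pos_of_pos hQ _).ne'
  have h1 : Set.range D.κ = (D.Q ^ (-(3 / 4) : ℝ)) • Set.range D.corner := by
    rw [← Set.range_smul]
    congr 1
    ext1 j
    simp only [corner]
    rw [smul_smul, mul_inv_cancel₀ hr, one_smul]
  have h2 : D.R • D.P = D.scale • convexHull ℝ (Set.range D.corner) := by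
    rw [P, Ptilde, h1, convexHull_smul, smul_smul, smul_smul, scale]
  rw [lattice, Set.Finite.mem_toFinset, ← Set.mem_smul_set_iff_inv_smul_mem₀ hs.ne', ← h2]
  rfl

namespace IsFermiPolyhedron

variable {D} {K : ℝ} (h : D.IsFermiPolyhedron K)
include h

theorem s_pos : 0 < D.s := by
  rcases Nat.eq_zero_or_pos D.s with h0 | h0
  · have h1 := h.Q_lower
    have h2 := Real.rpow_pos_of_pos h.Q_pos (-(1 / 4))
    rw [h0, Nat.cast_zero, inv_zero, mul_zero] at h1
    linarith
  · exact h0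

theorem K_pos : 0 < K := by
  by_contra hK
  have h1 := h.Q_lower
  have h2 := Real.rpow_pos_of_pos h.Q_pos (-(1 / 4))
  have h3 : K * (D.s : ℝ)⁻¹ ≤ 0 := mul_nonpos_of_nonpos_of_nonneg (not_lt.1 hK) (by positivity)
  linarith

theorem scale_pos : 0 < D.scale := by
  have hR : 0 < D.R := div_pos (mul_pos h.L_pos h.kF_pos) Real.two_pi_pos
  exact mul_pos (mul_pos hR h.σ_pos) (Real.rpow_pos_of_pos h.Q_pos _)

theorem sqrt_eps : √(K ^ 2 / D.s) = K * (D.s : ℝ) ^ (-(1 / 2) : ℝ) := by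
  rw [Real.sqrt_div (sq_nonneg K), Real.sqrt_sq h.K_pos.le, Real.rpow_neg (Nat.cast_nonneg _),
    ← Real.sqrt_eq_rpow, div_eq_mul_inv]

/-- The value of `ε` makes `√ε` the rescaled covering radius. The rescaled displacement `K Q^(-1/4)`
is also at most `ε`, by the condition relating `Q` to `s`. -/
theorem isSphereNet (hs : 100 * K ^ 2 ≤ D.s) :
    IsSphereNet D.spherePoint D.corner (K ^ 2 / D.s) := by
  have hK := h.K_pos
  have hs0 : (0 : ℝ) < D.s := by exact_mod_cast h.s_pos
  have hr := Real.rpow_pos_of_pos h.Q_pos (-(3 / 4))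
  have hscale : ∀ x y : E3, ‖(D.Q ^ (-(3 / 4) : ℝ))⁻¹ • x - (D.Q ^ (-(3 / 4) : ℝ))⁻¹ • y‖ =
      (D.Q ^ (-(3 / 4) : ℝ))⁻¹ * dist x y := by
    intro x y
    rw [← smul_sub, norm_smul, norm_inv, Real.norm_eq_abs, abs_of_pos hr, dist_eq_norm]
  refine ⟨by positivity, ?_, fun j => ?_, fun k hk => ?_, fun j => ?_⟩
  · rw [div_le_div_iff₀ hs0 (by norm_num)]; linarith
  · rw [spherePoint, norm_smul, norm_inv, Real.norm_eq_abs, abs_of_pos hr, h.κR_sphere,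
      inv_mul_cancel₀ hr.ne']
  · obtain ⟨j, hj⟩ := h.κR_covering ((D.Q ^ (-(3 / 4) : ℝ)) • k) (by
      rw [norm_smul, hk, mul_one, Real.norm_eq_abs, abs_of_pos hr])
    refine ⟨j, ?_⟩
    have h1 := hscale ((D.Q ^ (-(3 / 4) : ℝ)) • k) (D.κR j)
    rw [smul_smul, inv_mul_cancel₀ hr.ne', one_smul] at h1
    rw [spherePoint, h1, h.sqrt_eps, inv_mul_le_iff₀ hr]
    linarith
  · rw [corner, spherePoint, hscale, inv_mul_le_iff₀ hr]
    refine (h.κ_close j).trans ?_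
    have h1 : D.Q⁻¹ = D.Q ^ (-(3 / 4) : ℝ) * D.Q ^ (-(1 / 4) : ℝ) := by
      rw [← Real.rpow_add h.Q_pos, ← Real.rpow_neg_one]
      norm_num
    calc K * D.Q⁻¹ = D.Q ^ (-(3 / 4) : ℝ) * (K * D.Q ^ (-(1 / 4) : ℝ)) := by rw [h1]; ring
      _ ≤ D.Q ^ (-(3 / 4) : ℝ) * (K * (K * (D.s : ℝ)⁻¹)) := by
        gcongr
        exact h.Q_lower
      _ = _ := by rw [div_eq_mul_inv]; ring

theorem spherePoint_separated (i j : Fin D.s) (hij : i ≠ j) :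
    K⁻¹ * (D.s : ℝ) ^ (-(1 / 2) : ℝ) ≤ ‖D.spherePoint i - D.spherePoint j‖ := by
  have hr := Real.rpow_pos_of_pos h.Q_pos (-(3 / 4))
  rw [spherePoint, spherePoint, ← smul_sub, norm_smul, norm_inv, Real.norm_eq_abs,
    abs_of_pos hr, ← dist_eq_norm, le_inv_mul_iff₀ hr]
  linarith [h.κR_separated i j hij]

theorem one_le_Q (hs : K ≤ D.s) : 1 ≤ D.Q := by
  by_contra hQ
  have hs0 : (0 : ℝ) < D.s := by exact_mod_cast h.s_pos
  have h1 := Real.one_lt_rpow_of_pos_of_lt_one_of_neg h.Q_pos (not_le.1 hQ)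
    (by norm_num : (-(1 / 4) : ℝ) < 0)
  have h2 : K * (D.s : ℝ)⁻¹ ≤ 1 := by
    rw [← div_eq_mul_inv, div_le_one hs0]; exact hs
  linarith [h.Q_lower]

theorem s_le (hs : K ≤ D.s) : (D.s : ℝ) ≤ K * D.Q := by
  have hs0 : (0 : ℝ) < D.s := by exact_mod_cast h.s_pos
  have h1 : D.Q⁻¹ ≤ D.Q ^ (-(1 / 4) : ℝ) := by
    rw [← Real.rpow_neg_one]
    exact Real.rpow_le_rpow_of_exponent_le (h.one_le_Q hs) (by norm_num)
  have h2 := h1.trans h.Q_lower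
  rw [← div_eq_mul_inv, le_div_iff₀ hs0, inv_mul_le_iff₀ h.Q_pos] at h2
  linarith

/-- The rescaled polytope lies between the balls of radii `1 / 2` and `2`. A cube of half-side
`scale / 4` fits into the dilated inner ball, and its lattice points bound `N` below. -/
theorem card_bounds (hs : 100 * K ^ 2 ≤ D.s) :
    D.scale ≤ 4 * (D.N : ℝ) ^ (1 / 3 : ℝ) ∧
      D.lattice ⊆ freqBox (⌊2 * D.scale⌋₊ + 1) := by
  have hy := h.scale_pos
  have hnet := h.isSphereNet hs
  constructor
  · have hsub : freqBox ⌊D.scale / 4⌋₊ ⊆ D.lattice := by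
      intro q hq
      rw [D.mem_lattice_iff hy h.Q_pos]
      refine hnet.mem_convexHull_of_norm_le ?_
      rw [norm_smul, norm_inv, Real.norm_eq_abs, abs_of_pos hy, inv_mul_le_iff₀ hy]
      refine (sq_le_sq₀ (norm_nonneg _) (by positivity)).1 ?_
      rw [EuclideanSpace.real_norm_sq_eq, Fin.sum_univ_three]
      have h1 : ∀ i, latticeVec q i ^ 2 ≤ (D.scale / 4) ^ 2 := by
        intro i
        rw [← sq_abs]
        refine pow_le_pow_left₀ (abs_nonneg _) ?_ 2
        exact (abs_coord_le_of_mem_freqBox hq i).trans (Nat.floor_le (by positivity))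
      nlinarith [h1 0, h1 1, h1 2]
    have h1 := Finset.card_le_card hsub
    rw [card_freqBox, ← D.N_eq_card_lattice h.L_pos] at h1
    have h2 : (D.scale / 4) ^ 3 ≤ D.N := by
      have h3 : ((2 * ⌊D.scale / 4⌋₊ + 1 : ℕ) : ℝ) ^ 3 ≤ D.N := by exact_mod_cast h1
      refine le_trans (pow_le_pow_left₀ (by positivity) ?_ 3) h3
      have := Nat.lt_floor_add_one (D.scale / 4)
      push_cast
      linarith [(Nat.cast_nonneg ⌊D.scale / 4⌋₊ : (0 : ℝ) ≤ ⌊D.scale / 4⌋₊)]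
    have h4 := Real.rpow_le_rpow (by positivity) h2 (by norm_num : (0 : ℝ) ≤ 1 / 3)
    rw [← Real.rpow_natCast, ← Real.rpow_mul (by positivity)] at h4
    norm_num at h4
    norm_num
    linarith
  · intro q hq
    rw [D.mem_lattice_iff hy h.Q_pos] at hq
    have h1 := hnet.norm_le_two_of_mem_convexHull hq
    rw [norm_smul, norm_inv, Real.norm_eq_abs, abs_of_pos hy, inv_mul_le_iff₀ hy] at h1
    rw [mem_freqBox]
    intro i
    have h2 : |(q i : ℝ)| ≤ 2 * D.scale :=
      (PiLp.norm_apply_le (latticeVec q) i).trans (h1.trans_eq (mul_comm _ _))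
    have h3 := Nat.lt_floor_add_one (2 * D.scale)
    have h4 : ((|q i| : ℤ) : ℝ) ≤ ((⌊2 * D.scale⌋₊ + 1 : ℕ) : ℝ) := by
      push_cast; linarith
    exact_mod_cast h4

theorem corner_mul (j : Fin D.s) (μ : Fin 3) :
    D.corner j μ * (D.Q ^ (-(3 / 4) : ℝ) * D.prime μ) = D.p j μ := by
  have hr := (Real.rpow_pos_of_pos h.Q_pos (-(3 / 4))).ne'
  have hp : (D.prime μ : ℝ) ≠ 0 := by exact_mod_cast (h.prime_prime μ).ne_zero
  have h1 : D.corner j μ = (D.Q ^ (-(3 / 4) : ℝ))⁻¹ * ((D.p j μ : ℝ) / D.prime μ) := rfl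
  rw [h1]
  field_simp

theorem abs_p_le (hs : 100 * K ^ 2 ≤ D.s) (hs' : K ≤ D.s) (j : Fin D.s) (μ : Fin 3) :
    |(D.p j μ : ℝ)| ≤ 2 * K * D.Q := by
  have hr := Real.rpow_pos_of_pos h.Q_pos (-(3 / 4))
  have hr1 : D.Q ^ (-(3 / 4) : ℝ) ≤ 1 :=
    Real.rpow_le_one_of_one_le_of_nonpos (h.one_le_Q hs') (by norm_num)
  have hnet := h.isSphereNet hs
  have h1 : |D.corner j μ| ≤ 2 :=
    (PiLp.norm_apply_le (D.corner j) μ).trans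
      (by linarith [hnet.norm_corner_le j, hnet.small])
  rw [← h.corner_mul j μ, abs_mul, abs_mul, abs_of_pos hr, Nat.abs_cast]
  calc _ ≤ 2 * (1 * (K * D.Q)) := by
        gcongr
        exact h.prime_upper μ
    _ = _ := by ring

/-- The bound on the number of half-spaces needed in one cone. -/
theorem ceil_le {m : ℕ} (hm : √(D.s : ℝ) ≤ m) :
    ⌈2 * (16 * √(K ^ 2 / D.s) + 4 / m) / (K⁻¹ * (D.s : ℝ) ^ (-(1 / 2) : ℝ))⌉₊ ≤
      ⌈2 * (16 * K + 4) * K⌉₊ := by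
  have hK := h.K_pos
  have hs0 : (0 : ℝ) < D.s := by exact_mod_cast h.s_pos
  refine Nat.ceil_le_ceil ?_
  have h1 : (D.s : ℝ) ^ (-(1 / 2) : ℝ) = (√(D.s : ℝ))⁻¹ := by
    rw [Real.rpow_neg hs0.le, ← Real.sqrt_eq_rpow]
  have hq : 0 < √(D.s : ℝ) := Real.sqrt_pos.2 hs0
  have h2 : 4 / (m : ℝ) ≤ 4 * (√(D.s : ℝ))⁻¹ := by
    rw [← div_eq_mul_inv]
    gcongr
  rw [h.sqrt_eps, h1, div_le_iff₀ (by positivity)]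
  calc _ ≤ 2 * (16 * (K * (√(D.s : ℝ))⁻¹) + 4 * (√(D.s : ℝ))⁻¹) := by gcongr
    _ = _ := by field_simp

end IsFermiPolyhedron

end FermiData

/-! ### Explicit estimates for a single Fermi polyhedron -/

namespace FermiData.IsFermiPolyhedron

variable {D : FermiData} {K : ℝ} (h : D.IsFermiPolyhedron K)
include h

/-- The weighted exponential sum over the Fermi polyhedron is controlled by any kernel that
reproduces the weight. -/
theorem derivativeLebesgue_le (hs : 100 * K ^ 2 ≤ D.s) (hs' : K ≤ D.s) (t : (Fin 3 → ℤ) → ℝ)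
    (ht : t 0 = 0) (c : (Fin 3 → ℤ) → ℂ)
    (hc : ∀ q ∈ freqBox (⌊2 * D.scale⌋₊ + 1), c q = t q) :
    derivativeLebesgue D.lattice t ≤
      216 * D.s * 16 ^ (9 + ((2 * ⌈2 * (16 * K + 4) * K⌉₊ + 1) ^ 3) ^ 3) *
      ((2 + Real.log (2 * ⌈9 * (3 * K * D.Q + 24 * K ^ 3 * D.Q ^ 3) *
        (⌊2 * D.scale⌋₊ + 1 : ℕ)⌉₊ + 1)) ^ 3 *
        lebesgueNorm (freqBox (3 * (⌊2 * D.scale⌋₊ + 1))) c) := by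
  have hK := h.K_pos
  have hs0 : (0 : ℝ) < D.s := by exact_mod_cast h.s_pos
  have hs1 : (1 : ℝ) ≤ D.s := by exact_mod_cast h.s_pos
  -- The aperture `1 / m` matches the corner spacing of order `s^(-1/2)`, which keeps the facets per
  -- cone bounded while the number of cones is `O(s)`.
  set m : ℕ := Nat.sqrt D.s + 1 with hm
  have hm1 : √(D.s : ℝ) ≤ m := by
    rw [Real.sqrt_le_left (Nat.cast_nonneg _)]
    have := Nat.lt_succ_sqrt' D.s
    exact_mod_cast this.le
  have hm2 : ((Nat.sqrt D.s : ℕ) : ℝ) ^ 2 ≤ D.s := by exact_mod_cast Nat.sqrt_le' D.s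
  have hm3 : (m : ℝ) + 1 ≤ 3 * D.s := by
    have h1 : ((Nat.sqrt D.s : ℕ) : ℝ) ≤ D.s := by exact_mod_cast Nat.sqrt_le_self D.s
    rw [hm]; push_cast; linarith
  have hcount : 6 * (2 * (m : ℝ) + 1) ^ 2 ≤ 216 * D.s := by
    rw [hm]; push_cast
    nlinarith [sq_nonneg ((Nat.sqrt D.s : ℝ) - 1)]
  have hδ : 0 < K⁻¹ * (D.s : ℝ) ^ (-(1 / 2) : ℝ) :=
    mul_pos (inv_pos.2 hK) (Real.rpow_pos_of_pos hs0 _)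
  -- The first summand of `A` absorbs the cone walls, `m + 1 ≤ 3 s ≤ 3 K Q`; the second is `6 (K Q)
  -- (2 K Q)²` from the facet normals.
  have hmain := lebesgueNorm_le_of_cones (A := 3 * K * D.Q + 24 * K ^ 3 * D.Q ^ 3) (m := m)
    (b := 9 + ((2 * ⌈2 * (16 * K + 4) * K⌉₊ + 1) ^ 3) ^ 3)
    D.lattice (h.card_bounds hs).2 (fun k hk => ?_) t ht c hc
  · rw [derivativeLebesgue_eq]
    refine hmain.trans ?_
    have hlog : 0 ≤ Real.log (2 * (⌈9 * (3 * K * D.Q + 24 * K ^ 3 * D.Q ^ 3) *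
        (⌊2 * D.scale⌋₊ + 1 : ℕ)⌉₊ : ℝ) + 1) :=
      Real.log_nonneg (le_add_of_nonneg_left (by positivity))
    have := lebesgueNorm_nonneg (freqBox (3 * (⌊2 * D.scale⌋₊ + 1))) c
    gcongr
  · obtain ⟨S, hcard, hcoef, hmem⟩ := exists_halfSpaces_of_coneKey (h.isSphereNet hs) hδ
      h.spherePoint_separated (Real.rpow_pos_of_pos h.Q_pos (-(3 / 4))) D.prime
      (fun μ => (h.prime_prime μ).pos) D.p h.corner_mul (h.abs_p_le hs hs') h.prime_upper
      (Nat.succ_pos _ : 0 < m) h.scale_pos hk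
    refine ⟨S, hcard.trans ?_, fun f hf μ => (hcoef f hf μ).trans ?_, fun q => ?_⟩
    · have := h.ceil_le hm1
      gcongr
    · have := h.s_le hs'
      nlinarith
    · rw [hmem, D.mem_lattice_iff h.scale_pos h.Q_pos]

theorem box_le (hs : 100 * K ^ 2 ≤ D.s) (hN : 1 ≤ D.N) :
    ((⌊2 * D.scale⌋₊ + 1 : ℕ) : ℝ) ≤ 9 * (D.N : ℝ) ^ (1 / 3 : ℝ) := by
  have h1 := (h.card_bounds hs).1
  have h2 : (1 : ℝ) ≤ (D.N : ℝ) ^ (1 / 3 : ℝ) :=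
    Real.one_le_rpow (by exact_mod_cast hN) (by norm_num)
  have h3 := Nat.floor_le (mul_nonneg two_pos.le h.scale_pos.le)
  push_cast
  linarith

/-- As `Q ≤ K N^K`, the argument is at most a constant times `N^(3K + 1)`; one more `log N` absorbs
the constant. -/
theorem log_le (hs : 100 * K ^ 2 ≤ D.s) (hs' : K ≤ D.s) (hN : 1 ≤ D.N)
    (hlog : 2 + Real.log (162 * (3 * K + 24 * K ^ 3) * K ^ 3 + 3) ≤ Real.log D.N) :
    2 + Real.log (2 * ⌈9 * (3 * K * D.Q + 24 * K ^ 3 * D.Q ^ 3) *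
        (⌊2 * D.scale⌋₊ + 1 : ℕ)⌉₊ + 1) ≤ (3 * K + 2) * Real.log D.N := by
  have hK := h.K_pos
  have hQ := h.Q_pos
  have hQ1 := h.one_le_Q hs'
  have hN' : (1 : ℝ) ≤ D.N := by exact_mod_cast hN
  have hN0 : (0 : ℝ) < D.N := by linarith
  set B : ℕ := ⌊2 * D.scale⌋₊ + 1 with hB
  have hB9 : (B : ℝ) ≤ 9 * D.N := by
    refine (h.box_le hs hN).trans ?_
    have := Real.rpow_le_rpow_of_exponent_le hN' (by norm_num : (1 / 3 : ℝ) ≤ 1)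
    rw [Real.rpow_one] at this
    linarith
  have hNK : (1 : ℝ) ≤ (D.N : ℝ) ^ (3 * K + 1) := Real.one_le_rpow hN' (by positivity)
  have hQ3 : D.Q ^ 3 ≤ K ^ 3 * (D.N : ℝ) ^ (3 * K) := by
    refine (pow_le_pow_left₀ hQ.le h.Q_upper 3).trans (le_of_eq ?_)
    rw [mul_pow, ← Real.rpow_natCast ((D.N : ℝ) ^ K), ← Real.rpow_mul hN0.le]
    congr 2
    push_cast
    ring
  have hA : 3 * K * D.Q + 24 * K ^ 3 * D.Q ^ 3 ≤
      (3 * K + 24 * K ^ 3) * (K ^ 3 * (D.N : ℝ) ^ (3 * K)) := by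
    have h1 : D.Q ≤ D.Q ^ 3 := le_self_pow₀ hQ1 (by norm_num)
    calc _ ≤ 3 * K * D.Q ^ 3 + 24 * K ^ 3 * D.Q ^ 3 := by gcongr
      _ = (3 * K + 24 * K ^ 3) * D.Q ^ 3 := by ring
      _ ≤ _ := by gcongr
  have hM : 2 * (⌈9 * (3 * K * D.Q + 24 * K ^ 3 * D.Q ^ 3) * B⌉₊ : ℝ) + 1 ≤
      (162 * (3 * K + 24 * K ^ 3) * K ^ 3 + 3) * (D.N : ℝ) ^ (3 * K + 1) := by
    have h1 := (Nat.ceil_lt_add_one (by positivity :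
      0 ≤ 9 * (3 * K * D.Q + 24 * K ^ 3 * D.Q ^ 3) * B)).le
    have h2 : 9 * (3 * K * D.Q + 24 * K ^ 3 * D.Q ^ 3) * B ≤
        9 * ((3 * K + 24 * K ^ 3) * (K ^ 3 * (D.N : ℝ) ^ (3 * K))) * (9 * D.N) := by gcongr
    have h3 : (D.N : ℝ) ^ (3 * K + 1) = (D.N : ℝ) ^ (3 * K) * D.N := by
      rw [Real.rpow_add hN0, Real.rpow_one]
    have h4 : 9 * ((3 * K + 24 * K ^ 3) * (K ^ 3 * (D.N : ℝ) ^ (3 * K))) * (9 * D.N) =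
        81 * (3 * K + 24 * K ^ 3) * K ^ 3 * (D.N : ℝ) ^ (3 * K + 1) := by rw [h3]; ring
    linarith
  have hc0 : (0 : ℝ) < 162 * (3 * K + 24 * K ^ 3) * K ^ 3 + 3 := by positivity
  have h1 := Real.log_le_log (by positivity) hM
  rw [Real.log_mul hc0.ne' (by positivity), Real.log_rpow hN0] at h1
  linarith

theorem derivativeLebesgue_le_of_kernel (hs : 100 * K ^ 2 ≤ D.s) (hs' : K ≤ D.s) (hN : 1 ≤ D.N)
    (hlog : 2 + Real.log (162 * (3 * K + 24 * K ^ 3) * K ^ 3 + 3) ≤ Real.log D.N)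
    (t : (Fin 3 → ℤ) → ℝ) (ht : t 0 = 0) {V : ℝ}
    (hV : ∃ c : (Fin 3 → ℤ) → ℂ, (∀ q ∈ freqBox (⌊2 * D.scale⌋₊ + 1), c q = t q) ∧
      lebesgueNorm (freqBox (3 * (⌊2 * D.scale⌋₊ + 1))) c ≤ V) :
    derivativeLebesgue D.lattice t ≤
      216 * D.s * 16 ^ (9 + ((2 * ⌈2 * (16 * K + 4) * K⌉₊ + 1) ^ 3) ^ 3) *
      (((3 * K + 2) * Real.log D.N) ^ 3 * V) := by
  obtain ⟨c, hc, hcV⟩ := hV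
  refine (h.derivativeLebesgue_le hs hs' t ht c hc).trans ?_
  have h1 := h.log_le hs hs' hN hlog
  have h2 : 0 ≤ Real.log (2 * (⌈9 * (3 * K * D.Q + 24 * K ^ 3 * D.Q ^ 3) *
        (⌊2 * D.scale⌋₊ + 1 : ℕ)⌉₊ : ℝ) + 1) :=
    Real.log_nonneg (le_add_of_nonneg_left (by positivity))
  have h3 := lebesgueNorm_nonneg (freqBox (3 * (⌊2 * D.scale⌋₊ + 1))) c
  have h4 : 0 ≤ (3 * K + 2) * Real.log D.N := by linarith
  gcongr

end FermiData.IsFermiPolyhedron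

end

/-! ### Passage to sequences of constructions -/

theorem mainTheorem5 (K : ℝ) :
    ∃ C : ℝ, 0 < C ∧ ∀ D : ℕ → FermiData,
      (∀ n, (D n).IsFermiPolyhedron K) →
      Tendsto (fun n => (D n).N) atTop atTop →
      Tendsto (fun n => (D n).s) atTop atTop →
      (fun n => ((D n).N : ℝ) ^ (4 / 3 : ℝ)) =o[atTop] (fun n => (D n).Q) →
      ∀ᶠ n in atTop, ∀ μ ν : Fin 3,
        derivativeLebesgue (D n).lattice (fun q => (q μ : ℝ)) ≤
            C * ((D n).s : ℝ) * ((D n).N : ℝ) ^ (1 / 3 : ℝ) * Real.log ((D n).N : ℝ) ^ 3 ∧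
        derivativeLebesgue (D n).lattice (fun q => (q μ : ℝ) * (q ν : ℝ)) ≤
            C * ((D n).s : ℝ) * ((D n).N : ℝ) ^ (2 / 3 : ℝ) * Real.log ((D n).N : ℝ) ^ 4 := by
  -- The absolute value keeps `E` nonnegative before any construction is given; positivity of `K`
  -- only follows from one.
  set E : ℝ := 216 * 16 ^ (9 + ((2 * ⌈2 * (16 * K + 4) * K⌉₊ + 1) ^ 3) ^ 3) * |3 * K + 2| ^ 3 *
    (2 * Real.pi) ^ 3 with hE
  have hE0 : 0 ≤ E := by positivity
  refine ⟨3645 * E + 1, by positivity, fun D hD hN hs _ => ?_⟩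
  have hs1 := (tendsto_natCast_atTop_atTop (R := ℝ)).comp hs
  have hN1 := (tendsto_natCast_atTop_atTop (R := ℝ)).comp hN
  have hlog1 := Real.tendsto_log_atTop.comp hN1
  filter_upwards [hs1.eventually_ge_atTop (100 * K ^ 2), hs1.eventually_ge_atTop K,
    hN.eventually_ge_atTop 1, hlog1.eventually_ge_atTop 1, hlog1.eventually_ge_atTop
      (2 + Real.log (162 * (3 * K + 24 * K ^ 3) * K ^ 3 + 3))] with n hs hs' hN hl1 hlog
  simp only [Function.comp_apply] at hs hs' hl1 hlog
  intro μ ν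
  have h := hD n
  have hK := h.K_pos
  have hB := h.box_le hs hN
  rw [abs_of_pos (by positivity : 0 < 3 * K + 2)] at hE
  constructor
  · have h1 := h.derivativeLebesgue_le_of_kernel hs hs' hN hlog (fun q => (q μ : ℝ)) (by simp)
      (exists_kernel_coord (Nat.succ_pos _) μ)
    refine h1.trans ?_
    calc _ ≤ 216 * ((D n).s : ℝ) * 16 ^ (9 + ((2 * ⌈2 * (16 * K + 4) * K⌉₊ + 1) ^ 3) ^ 3) *
          (((3 * K + 2) * Real.log (D n).N) ^ 3 *
            (15 * (2 * Real.pi) ^ 3 * (9 * ((D n).N : ℝ) ^ (1 / 3 : ℝ)))) := by gcongr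
      _ = (135 * E) * (D n).s * ((D n).N : ℝ) ^ (1 / 3 : ℝ) * Real.log (D n).N ^ 3 := by
        rw [hE]; ring
      _ ≤ _ := by
        gcongr
        linarith
  · have h1 := h.derivativeLebesgue_le_of_kernel hs hs' hN hlog
      (fun q => (q μ : ℝ) * (q ν : ℝ)) (by simp)
      (exists_kernel_coord_mul (Nat.succ_pos _) μ ν)
    refine h1.trans ?_
    have h23 : (((D n).N : ℝ) ^ (1 / 3 : ℝ)) ^ 2 = ((D n).N : ℝ) ^ (2 / 3 : ℝ) := by
      rw [← Real.rpow_natCast, ← Real.rpow_mul (Nat.cast_nonneg _)]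
      norm_num
    calc _ ≤ 216 * ((D n).s : ℝ) * 16 ^ (9 + ((2 * ⌈2 * (16 * K + 4) * K⌉₊ + 1) ^ 3) ^ 3) *
          (((3 * K + 2) * Real.log (D n).N) ^ 3 *
            (45 * (2 * Real.pi) ^ 3 * (9 * ((D n).N : ℝ) ^ (1 / 3 : ℝ)) ^ 2)) := by gcongr
      _ = (3645 * E) * (D n).s * ((D n).N : ℝ) ^ (2 / 3 : ℝ) * Real.log (D n).N ^ 3 := by
        rw [hE, ← h23]; ring
      -- The constant is `3645 = 45 * 9²`. The argument yields `(log N)³` here too; the fourth power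
      -- follows from `log N ≥ 1`.
      _ ≤ _ := by
        gcongr
        · linarith
        · norm_num
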